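/- Let $\mathbb K$ be a field of characteristic zero. An admissible directed graph with $n\ge 1$ external vertices (labelled $1,\dots,n$) and $m\ge 0$ internal vertices (unlabelled) is a directed graph with a linear order on its edges, without double edges (two edges with the same source and the same target) and simple loops, in which every internal vertex has at most one incoming and at most two outgoing edges and is connected by an (undirected) path with an external vertex. Graphs that differ by a permutation $\sigma$ of the order of the edges are identified up to the sign of $\sigma$. The generalized IHX relations state the following: replace an internal vertex $v$ with at most one incoming and at most three outgoing edges (the rest of the graph being admissible) by two internal vertices joined by a new directed edge, placed last in the order, and sum over all ways of reconnecting the edges adjacent to $v$ to these two vertices that give admissible graphs; the sum is zero. Let $\mathsf{dgraphs}(n)$ be the resulting space of graphs modulo these relations, graded by $|\Gamma|=2\,\#\{\text{internal vertices}\}-\#\{\text{edges}\}$ and completed with respect to the number of internal vertices. For $1\le i\le n$ the composition $\Gamma_1\circ_i\Gamma_2$ inserts $\Gamma_2$ at the $i$-th external vertex of $\Gamma_1$ and sums over all ways of reconnecting the edges at that vertex to vertices of $\Gamma_2$ that give admissible graphs, the edges of $\Gamma_1$ preceding those of $\Gamma_2$. Let $\mathfrak g_{\mathsf{As},\mathsf{dgraphs}}=\prod_{n\ge1}s^{-n+1}\mathsf{dgraphs}(n)$,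 in which $\Gamma\in\mathsf{dgraphs}(n)$ has degree $|\Gamma|+n-1$, with the graded Lie bracket that is the graded commutator of $$\Gamma_1\star\Gamma_2=\sum_{i=1}^n(-1)^{|\Gamma_2|(1-n)+(i+1)(m-1)}\,\Gamma_1\circ_i\Gamma_2,\qquad \Gamma_1\in\mathsf{dgraphs}(n),\ \Gamma_2\in\mathsf{dgraphs}(m).$$ Two elements $\alpha,\beta$ of degree one (in particular two Maurer–Cartan elements, i.e. elements with $\alpha\star\alpha=0$) are called gauge equivalent if $\beta=\exp(\mathrm{ad}_\xi)\alpha=\sum_{k\ge0}\frac1{k!}\mathrm{ad}_\xi^k\alpha$ for some $\xi$ of degree zero for which this series converges, in the sense that its component in any given numbers of external and internal vertices is eventually constant. Let $a_1\in\mathsf{dgraphs}(1)$ be the sum of the two graphs with one external vertex, one internal vertex and a single edge between them (it encodes the Chevalley–Eilenberg differential $d_A$), and let $a_2\in\mathsf{dgraphs}(2)$ be the graph with two external vertices and nothing else (it encodes the commutative product). Put $\alpha_0=a_1+a_2$ and $\alpha_{\mathrm{Duf}}=a_1+\tilde m_{\mathrm{Duf}}$. Here $\tilde m_{\mathrm{Duf}}\in\mathsf{dgraphs}(2)$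 is the universal graph series of the product induced by the Duflo map (which, as a product, is Kontsevich's product), $$\tilde m_{\mathrm{Duf}}=J^{-1/2}\circ_1\big((G\circ_2J^{1/2})\circ_1J^{1/2}\big),$$ where an internal vertex with ordered outgoing edges to $a,b$ stands for the bracket $[a,b]$; $G\in\mathsf{dgraphs}(2)$, the product pulled back from $U\mathfrak g$ by symmetrization, is the exponential (for superposition of graphs with common external vertices) of the series of trees representing $\log(e^Xe^Y)-X-Y$, written as a Lie series by Dynkin's formula; and $J^{\pm1/2}\in\mathsf{dgraphs}(1)$ is $\exp\big(\pm\sum_{k\ge1}\frac{B_{2k}}{4k\,(2k)!}W_{2k}\big)$, with $B_{2k}$ the Bernoulli numbers and $W_{2k}$ the wheel with $2k$ spokes representing $\mathrm{tr}(\mathrm{ad}_x^{2k})$. Then the elements $\alpha_{\mathrm{Duf}}$ and $\alpha_0$ are not gauge equivalent. -/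

import Mathlib

namespace DufloGraph

/-- Vertices: `n` labelled external ones (`inl`), `m` internal ones (`inr`). -/
abbrev Vtx (n m : ℕ) : Type := Fin n ⊕ Fin m

/-- The vector space with basis the directed edges `(source, target)`. -/
abbrev EdgeSpace (K : Type*) [Field K] (n m : ℕ) : Type _ := (Vtx n m × Vtx n m) →₀ K

/-- Directed graphs on the vertices `Vtx n m` (internal vertices numbered for the time being) with a
linear order on their edges: the graph with edges `e₁ < ... < e_k` is the monomial `e₁ ∧ ... ∧ e_k`.
Permuting the order of the edges gives the sign of the permutation, and a graph with a double edge
is zero. -/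
abbrev GraphAlg (K : Type*) [Field K] (n m : ℕ) : Type _ := ExteriorAlgebra K (EdgeSpace K n m)

/-- The graph with the single edge `a → b`. -/
noncomputable def edge (K : Type*) [Field K] {n m : ℕ} (a b : Vtx n m) : GraphAlg K n m :=
  ExteriorAlgebra.ι K (Finsupp.single (a, b) (1 : K))

/-- The graph with the given ordered list of edges. -/
noncomputable def graph (K : Type*) [Field K] {n m : ℕ} (l : List (Vtx n m × Vtx n m)) :
    GraphAlg K n m :=
  (l.map fun e => edge K e.1 e.2).prod

/-- Replace the edge `a → b` by the sum of all edges from a vertex in `f a` to a vertex in `f b`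
(simple loops are not allowed and are sent to zero). -/
noncomputable def reconnectEdge (K : Type*) [Field K] {n m n' m' : ℕ}
    (f : Vtx n m → Finset (Vtx n' m')) : EdgeSpace K n m →ₗ[K] EdgeSpace K n' m' :=
  Finsupp.linearCombination K fun e : Vtx n m × Vtx n m =>
    if e.1 = e.2 then 0 else ∑ a ∈ f e.1, ∑ b ∈ f e.2, Finsupp.single (a, b) (1 : K)

/-- Sum over all ways to replace every endpoint `a` of every edge by a vertex in `f a`, keeping the
order of the edges. -/
noncomputable def reconnect (K : Type*) [Field K] {n m n' m' : ℕ}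
    (f : Vtx n m → Finset (Vtx n' m')) : GraphAlg K n m →ₐ[K] GraphAlg K n' m' :=
  ExteriorAlgebra.map (reconnectEdge K f)

/-- The internal vertex `v` is replaced by two vertices: one that takes the place of `v`, and a new
one, which gets the number `w`. All other vertices stay. -/
def splitVtx {n m : ℕ} (w : Fin (m + 1)) (v : Fin m) : Vtx n m → Finset (Vtx n (m + 1))
  | Sum.inl j => {Sum.inl j}
  | Sum.inr u => if u = v then {Sum.inr (w.succAbove u), Sum.inr w} else {Sum.inr (w.succAbove u)}

/-- The relations between graphs with `n` external and `m` internal vertices.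
* `loop`, `incoming`, `outgoing`: a graph with a simple loop, or with an internal vertex with two
  incoming or three outgoing edges, is zero ("keeping only admissible graphs").
* `relabel`: internal vertices are unlabelled.
* `ihx`: the generalized IHX relations. The vertex `v` is replaced by two vertices joined by a new
  directed edge, which is placed last, and one sums over all ways to reconnect the edges that were
  adjacent to `v`. By the first three relations only admissible graphs survive in the sum, and the
  relation has content only if `v` has at most one incoming and at most three outgoing edges. -/
inductive Rel (K : Type*) [Field K] (n : ℕ) : (m : ℕ) → GraphAlg K n m → Prop
  | loop {m : ℕ} (x y : GraphAlg K n m) (a : Vtx n m) : Rel K n m (x * edge K a a * y)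
  | incoming {m : ℕ} (x y : GraphAlg K n m) (v : Fin m) (a b : Vtx n m) :
      Rel K n m (x * (edge K a (Sum.inr v) * edge K b (Sum.inr v)) * y)
  | outgoing {m : ℕ} (x y : GraphAlg K n m) (v : Fin m) (a b c : Vtx n m) :
      Rel K n m (x * (edge K (Sum.inr v) a * edge K (Sum.inr v) b * edge K (Sum.inr v) c) * y)
  | relabel {m : ℕ} (x : GraphAlg K n m) (σ : Equiv.Perm (Fin m)) :
      Rel K n m (reconnect K (fun a => {Sum.map id σ a}) x - x)
  | ihx {m : ℕ} (x : GraphAlg K n m) (w : Fin (m + 1)) (v : Fin m) :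
      Rel K n (m + 1)
        (reconnect K (splitVtx w v) x * edge K (Sum.inr (w.succAbove v)) (Sum.inr w))

/-- The span of the relations. -/
noncomputable def relations (K : Type*) [Field K] (n m : ℕ) : Submodule K (GraphAlg K n m) :=
  Submodule.span K {x | Rel K n m x}

/-- Graphs modulo all relations. -/
abbrev GraphQuot (K : Type*) [Field K] (n m : ℕ) : Type _ := GraphAlg K n m ⧸ relations K n m

/-- The vertices of the graph inserted into the `i`-th external vertex (counted from `0`) of a graph
with `n₁ + 1` external and `m₁` internal vertices, as vertices of the composition. -/
def innerVtx {n₁ n₂ m₁ m₂ N M : ℕ} (hN : n₁ + n₂ = N) (hM : m₁ + m₂ = M) (i : Fin (n₁ + 1)) :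
    Vtx (n₂ + 1) m₂ → Vtx (N + 1) M
  | Sum.inl k => Sum.inl ⟨i + k, by omega⟩
  | Sum.inr u => Sum.inr ⟨m₁ + u, by omega⟩

/-- The vertices of the outer graph: the `i`-th external vertex is replaced by all the vertices of
the inserted graph, so that edges at this vertex are reconnected in all possible ways. -/
def outerVtx {n₁ n₂ m₁ m₂ N M : ℕ} (hN : n₁ + n₂ = N) (hM : m₁ + m₂ = M) (i : Fin (n₁ + 1)) :
    Vtx (n₁ + 1) m₁ → Finset (Vtx (N + 1) M)
  | Sum.inl k =>
      if k < i then {Sum.inl ⟨k, by omega⟩}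
      else if k = i then Finset.univ.image (innerVtx hN hM i)
      else {Sum.inl ⟨k + n₂, by omega⟩}
  | Sum.inr u => {Sum.inr ⟨u, by omega⟩}

/-- An admissible directed graph: no double edges, no simple loops, every internal vertex has at most
one incoming and at most two outgoing edges (so is at most trivalent), and every internal vertex is
connected by a path with an external vertex. -/
structure Admissible {n m : ℕ} (l : List (Vtx n m × Vtx n m)) : Prop where
  nodup : l.Nodup
  noLoop : ∀ e ∈ l, e.1 ≠ e.2
  incoming : ∀ v : Fin m, l.countP (fun e => e.2 = Sum.inr v) ≤ 1
  outgoing : ∀ v : Fin m, l.countP (fun e => e.1 = Sum.inr v) ≤ 2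
  connected : ∀ v : Fin m, ∃ j : Fin n,
    Relation.ReflTransGen (fun a b => (a, b) ∈ l ∨ (b, a) ∈ l) (Sum.inr v) (Sum.inl j)

/-- The part of `dgraphs(n)` that is spanned by the admissible graphs with `m` internal vertices and
of degree `d`, where the degree of a graph is `2 * #(internal vertices) - #(edges)`. -/
noncomputable def dgraphs (K : Type*) [Field K] (n m : ℕ) (d : ℤ) :
    Submodule K (GraphQuot K n m) :=
  Submodule.span K {x | ∃ l : List (Vtx n m × Vtx n m), Admissible l ∧
    2 * (m : ℤ) - (l.length : ℤ) = d ∧ x = Submodule.Quotient.mk (graph K l)}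

/-! The next facts show that insertion of graphs is compatible with the relations. -/

theorem reconnect_edge (K : Type*) [Field K] {n m n' m' : ℕ}
    (f : Vtx n m → Finset (Vtx n' m')) (a b : Vtx n m) :
    reconnect K f (edge K a b) =
      if a = b then 0 else ∑ a' ∈ f a, ∑ b' ∈ f b, edge K a' b' := by
  unfold reconnect edge
  rw [ExteriorAlgebra.map_apply_ι]
  simp only [reconnectEdge, Finsupp.linearCombination_single, one_smul]
  split_ifs <;> simp [map_sum]

theorem reconnect_reconnect (K : Type*) [Field K] {n m n' m' n'' m'' : ℕ}
    {f : Vtx n m → Finset (Vtx n' m')} {g : Vtx n' m' → Finset (Vtx n'' m'')}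
    (hf : Pairwise fun a b => Disjoint (f a) (f b)) (hg : Pairwise fun a b => Disjoint (g a) (g b))
    (x : GraphAlg K n m) :
    reconnect K g (reconnect K f x) = reconnect K (fun a => (f a).biUnion g) x := by
  have key : (reconnect K g).comp (reconnect K f) =
      reconnect K (fun a => (f a).biUnion g) := by
    apply ExteriorAlgebra.hom_ext
    apply Finsupp.lhom_ext'
    rintro ⟨a, b⟩
    apply LinearMap.ext_ring
    change reconnect K g (reconnect K f (edge K a b)) = reconnect K _ (edge K a b)
    rw [reconnect_edge, reconnect_edge]
    by_cases hab : a = b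
    · simp [hab]
    · simp only [hab, if_false, map_sum]
      rw [Finset.sum_biUnion (fun _ _ _ _ h => hg h)]
      refine Finset.sum_congr rfl fun a' ha' => ?_
      have h2 : ∀ c, ∑ d ∈ (f b).biUnion g, edge K c d = ∑ b' ∈ f b, ∑ d ∈ g b', edge K c d :=
        fun c => Finset.sum_biUnion (fun _ _ _ _ h => hg h)
      rw [Finset.sum_congr rfl fun c _ => h2 c, Finset.sum_comm]
      refine Finset.sum_congr rfl fun b' hb' => ?_
      rw [reconnect_edge, if_neg]
      rintro rfl
      exact Finset.disjoint_left.mp (hf hab) ha' hb'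
  exact DFunLike.congr_fun key x


theorem pairwise_single {n m n' m' : ℕ} {f : Vtx n m → Vtx n' m'} (hf : Function.Injective f) :
    Pairwise fun a b => Disjoint ({f a} : Finset (Vtx n' m')) {f b} := by
  intro a b h
  simpa using fun h' => h (hf h')

theorem innerVtx_injective {n₁ n₂ m₁ m₂ N M : ℕ} (hN : n₁ + n₂ = N) (hM : m₁ + m₂ = M)
    (i : Fin (n₁ + 1)) : Function.Injective (innerVtx (m₂ := m₂) hN hM i) := by
  rintro (a | a) (b | b) h <;> simp [innerVtx, Fin.ext_iff] at h ⊢ <;> omega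

theorem outerVtx_pairwise {n₁ n₂ m₁ m₂ N M : ℕ} (hN : n₁ + n₂ = N) (hM : m₁ + m₂ = M)
    (i : Fin (n₁ + 1)) :
    Pairwise fun a b => Disjoint (outerVtx (m₂ := m₂) hN hM i a) (outerVtx hN hM i b) := by
  intro a b hab
  rw [Finset.disjoint_left]
  intro c hc hc'
  rcases a with (a | a) <;> rcases b with (b | b) <;> rcases c with (c | c) <;>
    simp only [outerVtx] at hc hc' <;> (try split_ifs at hc hc') <;>
    simp [innerVtx, Fin.ext_iff] at * <;> omega

theorem splitVtx_pairwise {n m : ℕ} (w : Fin (m + 1)) (v : Fin m) :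
    Pairwise fun a b : Vtx n m => Disjoint (splitVtx w v a) (splitVtx w v b) := by
  intro a b hab
  rw [Finset.disjoint_left]
  intro c hc hc'
  rcases a with (a | a) <;> rcases b with (b | b) <;>
    simp only [splitVtx] at hc hc' <;> (try split_ifs at hc hc') <;>
    rcases c with (c | c) <;>
    simp only [Finset.mem_singleton, Finset.mem_insert, Sum.inl.injEq, Sum.inr.injEq, ne_eq,
      reduceCtorEq, or_self] at * <;>
    grind [Fin.succAbove_ne, Fin.succAbove_right_injective]

theorem reconnect_edge_single (K : Type*) [Field K] {n m n' m' : ℕ} (f : Vtx n m → Vtx n' m')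
    (a b : Vtx n m) :
    reconnect K (fun a => {f a}) (edge K a b) = if a = b then 0 else edge K (f a) (f b) := by
  rw [reconnect_edge]; simp

theorem edge_mul (K : Type*) [Field K] {n m : ℕ} (a b : Vtx n m) (x : GraphAlg K n m) :
    edge K a b * x = ExteriorAlgebra.map (-LinearMap.id) x * edge K a b := by
  induction x using ExteriorAlgebra.induction with
  | algebraMap r => simp [Algebra.commutes]
  | ι z =>
    rw [ExteriorAlgebra.map_apply_ι]
    have := ExteriorAlgebra.ι_add_mul_swap (R := K) (Finsupp.single (a, b) (1 : K)) z
    simp only [LinearMap.neg_apply, LinearMap.id_apply, map_neg, neg_mul]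
    exact eq_neg_of_add_eq_zero_left this
  | mul x y hx hy => rw [map_mul, ← mul_assoc, hx, mul_assoc, hy, mul_assoc]
  | add x y hx hy => rw [map_add, mul_add, add_mul, hx, hy]

theorem parity_reconnect (K : Type*) [Field K] {n m n' m' : ℕ}
    (f : Vtx n m → Finset (Vtx n' m')) (x : GraphAlg K n m) :
    ExteriorAlgebra.map (-LinearMap.id) (reconnect K f x) =
      reconnect K f (ExteriorAlgebra.map (-LinearMap.id) x) := by
  have : (ExteriorAlgebra.map (-LinearMap.id)).comp (reconnect K f) =
      (reconnect K f).comp (ExteriorAlgebra.map (-LinearMap.id)) := by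
    unfold reconnect
    rw [ExteriorAlgebra.map_comp_map, ExteriorAlgebra.map_comp_map]
    congr 1
    ext; simp
  exact DFunLike.congr_fun this x

theorem mem_relations {K : Type*} [Field K] {n m : ℕ} {x : GraphAlg K n m} (h : Rel K n m x) :
    x ∈ relations K n m := Submodule.subset_span h

theorem outerVtx_biUnion {n₁ n₂ m₁ m₂ N M m₁' m₂' M' : ℕ} (hN : n₁ + n₂ = N) (hM : m₁ + m₂ = M)
    (hM' : m₁' + m₂' = M') (i : Fin (n₁ + 1)) (g : Vtx (N + 1) M → Finset (Vtx (N + 1) M'))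
    (t : Fin m₁ → Fin m₁')
    (hl : ∀ k, g (Sum.inl k) = {Sum.inl k})
    (hr : Finset.univ.image (innerVtx (m₂ := m₂') hN hM' i) =
      (Finset.univ.image (innerVtx (m₂ := m₂) hN hM i)).biUnion g)
    (ht : ∀ u : Fin m₁, g (Sum.inr ⟨u, by omega⟩) = {Sum.inr ⟨t u, by omega⟩})
    (a : Vtx (n₁ + 1) m₁) :
    (outerVtx (m₂ := m₂) hN hM i a).biUnion g =
      outerVtx (m₂ := m₂') hN hM' i (Sum.map id t a) := by
  rcases a with k | u
  · simp only [outerVtx, Sum.map_inl, id]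
    split_ifs
    · rw [Finset.singleton_biUnion, hl]
    · rw [hr]
    · rw [Finset.singleton_biUnion, hl]
  · simp only [outerVtx, Sum.map_inr]
    rw [Finset.singleton_biUnion, ht]

theorem innerVtx_inr {n₁ n₂ m₁ m₂ N M : ℕ} (hN : n₁ + n₂ = N) (hM : m₁ + m₂ = M)
    (i : Fin (n₁ + 1)) (u : Fin m₂) :
    innerVtx hN hM i (Sum.inr u) = Sum.inr ⟨m₁ + u, by omega⟩ := rfl

theorem innerVtx_inl {n₁ n₂ m₁ m₂ N M : ℕ} (hN : n₁ + n₂ = N) (hM : m₁ + m₂ = M)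
    (i : Fin (n₁ + 1)) (k : Fin (n₂ + 1)) :
    innerVtx (m₂ := m₂) hN hM i (Sum.inl k) = Sum.inl ⟨i + k, by omega⟩ := rfl

theorem splitVtx_self {n m : ℕ} (w : Fin (m + 1)) (v : Fin m) :
    splitVtx w v (Sum.inr v : Vtx n m) = {Sum.inr (w.succAbove v), Sum.inr w} := by
  simp [splitVtx]

theorem splitVtx_ne {n m : ℕ} (w : Fin (m + 1)) {u v : Fin m} (h : u ≠ v) :
    splitVtx w v (Sum.inr u : Vtx n m) = {Sum.inr (w.succAbove u)} := by
  simp [splitVtx, h]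

theorem mem_splitVtx {n m : ℕ} (w : Fin (m + 1)) (u v : Fin m) (c : Vtx n (m + 1)) :
    c ∈ splitVtx w v (Sum.inr u : Vtx n m) ↔
      c = Sum.inr (w.succAbove u) ∨ (u = v ∧ c = Sum.inr w) := by
  by_cases h : u = v
  · subst h; simp [splitVtx]
  · simp [splitVtx, h]

theorem succAbove_shift {m₁ m : ℕ} (w : Fin (m + 1)) (u : Fin m) :
    (⟨m₁ + w, by omega⟩ : Fin (m₁ + m + 1)).succAbove ⟨m₁ + u, by omega⟩ =
      ⟨m₁ + w.succAbove u, by omega⟩ := by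
  simp only [Fin.succAbove, Fin.lt_def, Fin.ext_iff, Fin.val_castSucc]
  by_cases h : (u : ℕ) < w <;> simp [h] <;> omega

theorem succAbove_cast {m₂ m : ℕ} (w : Fin (m + 1)) (u : Fin m) :
    (⟨w, by omega⟩ : Fin (m + m₂ + 1)).succAbove ⟨u, by omega⟩ =
      ⟨w.succAbove u, by omega⟩ := by
  simp only [Fin.succAbove, Fin.lt_def, Fin.ext_iff, Fin.val_castSucc]
  by_cases h : (u : ℕ) < w <;> simp [h]

theorem comp_rel_right {K : Type*} [Field K] {n₁ n₂ m₁ m₂ N M : ℕ} (hN : n₁ + n₂ = N)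
    (hM : m₁ + m₂ = M) (i : Fin (n₁ + 1)) (x : GraphAlg K (n₁ + 1) m₁)
    {y : GraphAlg K (n₂ + 1) m₂} (hy : Rel K (n₂ + 1) m₂ y) :
    reconnect K (outerVtx (m₂ := m₂) hN hM i) x *
      reconnect K (fun a => {innerVtx hN hM i a}) y ∈ relations K (N + 1) M := by
  cases hy with
  | loop p q a => simp [reconnect_edge]
  | incoming p q v a b =>
    simp only [map_mul, reconnect_edge_single]
    split_ifs
    all_goals try simp only [zero_mul, mul_zero]; exact Submodule.zero_mem _
    rw [← mul_assoc, ← mul_assoc]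
    exact mem_relations (Rel.incoming _ _ _ _ _)
  | outgoing p q v a b c =>
    simp only [map_mul, reconnect_edge_single]
    split_ifs
    all_goals try simp only [zero_mul, mul_zero]; exact Submodule.zero_mem _
    rw [← mul_assoc, ← mul_assoc]
    exact mem_relations (Rel.outgoing _ _ _ _ _ _)
  | relabel y σ =>
    subst hM
    let τ : Equiv.Perm (Fin (m₁ + m₂)) := finSumFinEquiv.permCongr (Equiv.sumCongr 1 σ)
    have h₁ : ∀ u : Fin m₁, τ ⟨u, by omega⟩ = ⟨u, by omega⟩ := fun u => by
      change τ (Fin.castAdd m₂ u) = Fin.castAdd m₂ u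
      simp [τ, Equiv.permCongr_apply]
    have h₂ : ∀ u : Fin m₂, τ ⟨m₁ + u, by omega⟩ = ⟨m₁ + σ u, by omega⟩ := fun u => by
      change τ (Fin.natAdd m₁ u) = Fin.natAdd m₁ (σ u)
      simp [τ, Equiv.permCongr_apply]
    have hτ : Function.Injective (Sum.map id τ : Vtx (N + 1) (m₁ + m₂) → _) :=
      Function.injective_id.sumMap τ.injective
    have hσ : Function.Injective (Sum.map id σ : Vtx (n₂ + 1) m₂ → _) :=
      Function.injective_id.sumMap σ.injective
    have hc : ∀ a : Vtx (n₂ + 1) m₂, Sum.map id τ (innerVtx hN rfl i a) =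
        innerVtx hN rfl i (Sum.map id σ a) := by
      rintro (k | u)
      · rfl
      · simp [innerVtx, h₂]
    have e₁ : reconnect K (fun a => {Sum.map id τ a})
        (reconnect K (outerVtx (m₂ := m₂) hN rfl i) x) = reconnect K (outerVtx hN rfl i) x := by
      rw [reconnect_reconnect K (outerVtx_pairwise _ _ _) (pairwise_single hτ)]
      congr 2
      funext a
      rw [outerVtx_biUnion hN rfl rfl i (fun a => {Sum.map id τ a}) id (fun _ => rfl) ?_
        (fun u => by simp [h₁]), Sum.map_id_id, id]
      rw [Finset.biUnion_singleton, Finset.image_image]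
      ext c
      simp only [Finset.mem_image, Finset.mem_univ, true_and, Function.comp_apply, hc]
      constructor
      · rintro ⟨a, rfl⟩
        exact ⟨Sum.map id σ.symm a, by rcases a with a | a <;> simp⟩
      · rintro ⟨a, rfl⟩
        exact ⟨_, rfl⟩
    have e₂ : reconnect K (fun a => {Sum.map id τ a})
        (reconnect K (fun a => {innerVtx hN rfl i a}) y) =
        reconnect K (fun a => {innerVtx hN rfl i a}) (reconnect K (fun a => {Sum.map id σ a}) y) := by
      rw [reconnect_reconnect K (pairwise_single (innerVtx_injective _ _ _)) (pairwise_single hτ),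
        reconnect_reconnect K (pairwise_single hσ) (pairwise_single (innerVtx_injective _ _ _))]
      congr 2
      funext a
      rw [Finset.singleton_biUnion, Finset.singleton_biUnion, hc]
    rw [map_sub, mul_sub, ← e₂]
    nth_rewrite 1 [← e₁]
    rw [← map_mul]
    exact mem_relations (Rel.relabel _ _)
  | @ihx m y w v =>
    obtain rfl : M = m₁ + m + 1 := by omega
    have hc : ∀ a : Vtx (n₂ + 1) m,
        (splitVtx w v a).image (innerVtx (m₁ := m₁) hN hM i) =
        splitVtx (⟨m₁ + w, by omega⟩ : Fin (m₁ + m + 1)) ⟨m₁ + v, by omega⟩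
          (innerVtx (m₁ := m₁) hN rfl i a) := by
      rintro (k | u)
      · rfl
      · ext c
        simp only [innerVtx_inr, mem_splitVtx, succAbove_shift, Finset.mem_image]
        constructor
        · rintro ⟨a, (rfl | ⟨rfl, rfl⟩), rfl⟩
          · exact Or.inl rfl
          · exact Or.inr ⟨rfl, rfl⟩
        · rintro (rfl | ⟨h, rfl⟩)
          · exact ⟨_, Or.inl rfl, rfl⟩
          · refine ⟨_, Or.inr ⟨?_, rfl⟩, rfl⟩
            simpa [Fin.ext_iff] using h
    have e₁ : reconnect K (outerVtx (m₂ := m + 1) hN hM i) x =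
        reconnect K (splitVtx (⟨m₁ + w, by omega⟩ : Fin (m₁ + m + 1)) ⟨m₁ + v, by omega⟩)
          (reconnect K (outerVtx (m₂ := m) hN rfl i) x) := by
      rw [reconnect_reconnect K (outerVtx_pairwise _ _ _) (splitVtx_pairwise _ _)]
      congr 2
      funext a
      rw [outerVtx_biUnion hN rfl hM i _ id (fun _ => rfl) ?_ ?_, Sum.map_id_id, id]
      · ext c
        simp only [Finset.mem_biUnion, Finset.mem_image, Finset.mem_univ, true_and,
          exists_exists_eq_and, ← hc]
        constructor
        · rintro ⟨a, rfl⟩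
          rcases a with k | u
          · exact ⟨Sum.inl k, Sum.inl k, by simp [splitVtx], rfl⟩
          · rcases Fin.eq_self_or_eq_succAbove w u with rfl | ⟨u', rfl⟩
            · exact ⟨Sum.inr v, Sum.inr u, by simp [splitVtx], rfl⟩
            · exact ⟨Sum.inr u', _, (mem_splitVtx _ _ _ _).2 (Or.inl rfl), rfl⟩
        · rintro ⟨_, a, _, rfl⟩
          exact ⟨a, rfl⟩
      · intro u
        rw [splitVtx_ne _ (by simp [Fin.ext_iff]; omega)]
        congr 2
        rw [Fin.succAbove_of_castSucc_lt _ _ (by simp [Fin.lt_def]; omega)]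
        rfl
    have e₂ : reconnect K (fun a => {innerVtx (m₁ := m₁) hN hM i a}) (reconnect K (splitVtx w v) y) =
        reconnect K (splitVtx (⟨m₁ + w, by omega⟩ : Fin (m₁ + m + 1)) ⟨m₁ + v, by omega⟩)
          (reconnect K (fun a => {innerVtx hN rfl i a}) y) := by
      rw [reconnect_reconnect K (splitVtx_pairwise _ _) (pairwise_single (innerVtx_injective _ _ _)),
        reconnect_reconnect K (pairwise_single (innerVtx_injective _ _ _)) (splitVtx_pairwise _ _)]
      congr 2
      funext a
      rw [Finset.singleton_biUnion, Finset.biUnion_singleton, hc]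
    rw [map_mul, e₂, e₁, reconnect_edge_single, if_neg (by simp [Fin.succAbove_ne]), ← mul_assoc,
      ← map_mul, innerVtx_inr, innerVtx_inr, ← succAbove_shift]
    exact mem_relations (Rel.ihx _ _ _)

theorem reconnect_edge_inr (K : Type*) [Field K] {n m n' m' : ℕ}
    {f : Vtx n m → Finset (Vtx n' m')} {v : Fin m} {v' : Fin m'}
    (hv : f (Sum.inr v) = {Sum.inr v'}) (a : Vtx n m) :
    reconnect K f (edge K a (Sum.inr v)) =
      ∑ a' ∈ (if a = Sum.inr v then ∅ else f a), edge K a' (Sum.inr v') := by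
  rw [reconnect_edge]
  split_ifs <;> simp [hv]

theorem reconnect_inr_edge (K : Type*) [Field K] {n m n' m' : ℕ}
    {f : Vtx n m → Finset (Vtx n' m')} {v : Fin m} {v' : Fin m'}
    (hv : f (Sum.inr v) = {Sum.inr v'}) (a : Vtx n m) :
    reconnect K f (edge K (Sum.inr v) a) =
      ∑ a' ∈ (if Sum.inr v = a then ∅ else f a), edge K (Sum.inr v') a' := by
  rw [reconnect_edge]
  split_ifs <;> simp [hv]

theorem comp_rel_left {K : Type*} [Field K] {n₁ n₂ m₁ m₂ N M : ℕ} (hN : n₁ + n₂ = N)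
    (hM : m₁ + m₂ = M) (i : Fin (n₁ + 1)) {x : GraphAlg K (n₁ + 1) m₁}
    (y : GraphAlg K (n₂ + 1) m₂) (hx : Rel K (n₁ + 1) m₁ x) :
    reconnect K (outerVtx (m₂ := m₂) hN hM i) x *
      reconnect K (fun a => {innerVtx hN hM i a}) y ∈ relations K (N + 1) M := by
  have hv : ∀ v : Fin m₁, outerVtx (m₂ := m₂) hN hM i (Sum.inr v) =
    {Sum.inr ⟨v, by omega⟩} := fun _ => rfl
  cases hx with
  | loop p q a => simp [reconnect_edge]
  | incoming p q v a b =>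
    simp only [map_mul, reconnect_edge_inr K (hv v)]
    simp only [Finset.sum_mul, Finset.mul_sum]
    refine Submodule.sum_mem _ fun a' _ => Submodule.sum_mem _ fun b' _ => ?_
    rw [mul_assoc _ _ (reconnect K _ y)]
    exact mem_relations (Rel.incoming _ _ _ _ _)
  | outgoing p q v a b c =>
    simp only [map_mul, reconnect_inr_edge K (hv v)]
    simp only [Finset.sum_mul, Finset.mul_sum]
    refine Submodule.sum_mem _ fun a' _ => Submodule.sum_mem _ fun b' _ =>
      Submodule.sum_mem _ fun c' _ => ?_
    rw [mul_assoc _ _ (reconnect K _ y)]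
    exact mem_relations (Rel.outgoing _ _ _ _ _ _)
  | relabel x σ =>
    subst hM
    let τ : Equiv.Perm (Fin (m₁ + m₂)) := finSumFinEquiv.permCongr (Equiv.sumCongr σ 1)
    have h₁ : ∀ u : Fin m₁, τ ⟨u, by omega⟩ = ⟨σ u, by omega⟩ := fun u => by
      change τ (Fin.castAdd m₂ u) = Fin.castAdd m₂ (σ u)
      simp [τ, Equiv.permCongr_apply]
    have h₂ : ∀ u : Fin m₂, τ ⟨m₁ + u, by omega⟩ = ⟨m₁ + u, by omega⟩ := fun u => by
      change τ (Fin.natAdd m₁ u) = Fin.natAdd m₁ u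
      simp [τ, Equiv.permCongr_apply]
    have hτ : Function.Injective (Sum.map id τ : Vtx (N + 1) (m₁ + m₂) → _) :=
      Function.injective_id.sumMap τ.injective
    have hσ : Function.Injective (Sum.map id σ : Vtx (n₁ + 1) m₁ → _) :=
      Function.injective_id.sumMap σ.injective
    have hc : ∀ a : Vtx (n₂ + 1) m₂, Sum.map id τ (innerVtx hN rfl i a) =
        innerVtx hN rfl i a := by
      rintro (k | u)
      · rfl
      · simp [innerVtx, h₂]
    have e₁ : reconnect K (fun a => {Sum.map id τ a})
        (reconnect K (outerVtx (m₂ := m₂) hN rfl i) x) =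
        reconnect K (outerVtx hN rfl i) (reconnect K (fun a => {Sum.map id σ a}) x) := by
      rw [reconnect_reconnect K (outerVtx_pairwise _ _ _) (pairwise_single hτ),
        reconnect_reconnect K (pairwise_single hσ) (outerVtx_pairwise _ _ _)]
      congr 2
      funext a
      rw [outerVtx_biUnion hN rfl rfl i (fun a => {Sum.map id τ a}) σ (fun _ => rfl) ?_
        (fun u => by simp [h₁]), Finset.singleton_biUnion]
      rw [Finset.biUnion_singleton, Finset.image_image]
      congr 1
      funext a
      exact (hc a).symm
    have e₂ : reconnect K (fun a => {Sum.map id τ a})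
        (reconnect K (fun a => {innerVtx hN rfl i a}) y) =
        reconnect K (fun a => {innerVtx hN rfl i a}) y := by
      rw [reconnect_reconnect K (pairwise_single (innerVtx_injective _ _ _)) (pairwise_single hτ)]
      congr 2
      funext a
      rw [Finset.singleton_biUnion, hc]
    rw [map_sub, sub_mul, ← e₁]
    nth_rewrite 1 [← e₂]
    rw [← map_mul]
    exact mem_relations (Rel.relabel _ _)
  | @ihx m x w v =>
    obtain rfl : M = m + m₂ + 1 := by omega
    let W : Fin (m + m₂ + 1) := ⟨w, by omega⟩
    let V : Fin (m + m₂) := ⟨v, by omega⟩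
    have hc : ∀ a : Vtx (n₂ + 1) m₂, splitVtx W V (innerVtx (m₁ := m) hN rfl i a) =
        {innerVtx hN hM i a} := by
      rintro (k | u)
      · rfl
      · rw [innerVtx_inr, innerVtx_inr, splitVtx_ne _ (by simp [V, Fin.ext_iff]; omega),
          Fin.succAbove_of_le_castSucc _ _ (by simp [W, Fin.le_def]; omega)]
        simp [Fin.ext_iff]
        omega
    have e₁ : reconnect K (outerVtx (m₂ := m₂) hN hM i) (reconnect K (splitVtx w v) x) =
        reconnect K (splitVtx W V) (reconnect K (outerVtx (m₂ := m₂) hN rfl i) x) := by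
      rw [reconnect_reconnect K (splitVtx_pairwise _ _) (outerVtx_pairwise _ _ _),
        reconnect_reconnect K (outerVtx_pairwise _ _ _) (splitVtx_pairwise _ _)]
      congr 2
      funext a
      rcases a with k | u
      · simp only [splitVtx, Finset.singleton_biUnion, outerVtx]
        split_ifs
        · rfl
        · rw [Finset.image_biUnion]
          simp only [hc]
          rw [Finset.biUnion_singleton]
        · rfl
      · ext c
        simp only [outerVtx, Finset.singleton_biUnion, mem_splitVtx, Finset.mem_biUnion, W, V,
          succAbove_cast]
        constructor
        · rintro ⟨_, (rfl | ⟨rfl, rfl⟩), h⟩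
          · exact Or.inl (by simpa [outerVtx] using h)
          · exact Or.inr ⟨rfl, by simpa [outerVtx] using h⟩
        · rintro (rfl | ⟨h, rfl⟩)
          · exact ⟨_, Or.inl rfl, by simp⟩
          · exact ⟨_, Or.inr ⟨by simpa [Fin.ext_iff] using h, rfl⟩, by simp⟩
    have e₂ : reconnect K (fun a => {innerVtx (m₁ := m + 1) hN hM i a}) y =
        reconnect K (splitVtx W V) (reconnect K (fun a => {innerVtx hN rfl i a}) y) := by
      rw [reconnect_reconnect K (pairwise_single (innerVtx_injective _ _ _)) (splitVtx_pairwise _ _)]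
      congr 2
      funext a
      rw [Finset.singleton_biUnion, hc]
    have e₃ : reconnect K (outerVtx (m₂ := m₂) hN hM i)
        (edge K (Sum.inr (w.succAbove v)) (Sum.inr w)) =
        edge K (Sum.inr (W.succAbove V)) (Sum.inr W) := by
      rw [reconnect_edge, if_neg (by simp [Fin.succAbove_ne])]
      simp [outerVtx, W, V, succAbove_cast]
    rw [map_mul, e₁, e₂, e₃, mul_assoc, edge_mul, parity_reconnect, ← mul_assoc, ← map_mul]
    exact mem_relations (Rel.ihx _ _ _)

/-- Insertion of graphs at the `i`-th external vertex, before passing to the quotient. The edges of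
the outer graph come before those of the inserted graph. -/
noncomputable def compAux (K : Type*) [Field K] {n₁ n₂ m₁ m₂ N M : ℕ} (hN : n₁ + n₂ = N)
    (hM : m₁ + m₂ = M) (i : Fin (n₁ + 1)) :
    GraphAlg K (n₁ + 1) m₁ →ₗ[K] GraphAlg K (n₂ + 1) m₂ →ₗ[K] GraphAlg K (N + 1) M :=
  (LinearMap.mul K (GraphAlg K (N + 1) M)).compl₁₂
    (reconnect K (outerVtx (m₂ := m₂) hN hM i)).toLinearMap
    (reconnect K fun a => {innerVtx hN hM i a}).toLinearMap

/-- The operadic composition `Γ₁ ∘ᵢ Γ₂` (external vertices are counted from `0`). -/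
noncomputable def comp (K : Type*) [Field K] {n₁ n₂ m₁ m₂ N M : ℕ} (hN : n₁ + n₂ = N)
    (hM : m₁ + m₂ = M) (i : Fin (n₁ + 1)) :
    GraphQuot K (n₁ + 1) m₁ →ₗ[K] GraphQuot K (n₂ + 1) m₂ →ₗ[K] GraphQuot K (N + 1) M :=
  Submodule.liftQ (relations K (n₁ + 1) m₁)
    (LinearMap.flip (Submodule.liftQ (relations K (n₂ + 1) m₂)
      (((compAux K hN hM i).compr₂ (relations K (N + 1) M).mkQ).flip) (by
        refine Submodule.span_le.2 fun y hy => LinearMap.ext fun x => ?_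
        exact (Submodule.Quotient.mk_eq_zero _).2 (comp_rel_right hN hM i x hy))))
    (by
      refine Submodule.span_le.2 fun x hx => LinearMap.ext fun y => ?_
      obtain ⟨y, rfl⟩ := Submodule.Quotient.mk_surjective _ y
      exact (Submodule.Quotient.mk_eq_zero _).2 (comp_rel_left hN hM i y hx))

theorem comp_mk (K : Type*) [Field K] {n₁ n₂ m₁ m₂ N M : ℕ} (hN : n₁ + n₂ = N)
    (hM : m₁ + m₂ = M) (i : Fin (n₁ + 1)) (x : GraphAlg K (n₁ + 1) m₁)
    (y : GraphAlg K (n₂ + 1) m₂) :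
    comp K hN hM i (Submodule.Quotient.mk x) (Submodule.Quotient.mk y) =
      Submodule.Quotient.mk (reconnect K (outerVtx (m₂ := m₂) hN hM i) x *
        reconnect K (fun a => {innerVtx hN hM i a}) y) :=
  rfl

/-- Formal series of graphs with `n` external vertices: one term for every number of internal
vertices. -/
abbrev Series (K : Type*) [Field K] (n : ℕ) : Type _ := ∀ m : ℕ, GraphQuot K n m

/-- The operadic composition, extended to formal series of graphs. -/
noncomputable def seriesComp (K : Type*) [Field K] {n₁ n₂ N : ℕ} (hN : n₁ + n₂ = N)
    (i : Fin (n₁ + 1)) (x : Series K (n₁ + 1)) (y : Series K (n₂ + 1)) : Series K (N + 1) :=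
  fun M => ∑ r : Finset.HasAntidiagonal.antidiagonal M,
    comp K hN (Finset.HasAntidiagonal.mem_antidiagonal.1 r.2) i (x r.1.1) (y r.1.2)

/-- Families of formal series of graphs, one for every arity; the index `n` stands for arity
`n + 1`. -/
abbrev Family (K : Type*) [Field K] : Type _ := ∀ n : ℕ, Series K (n + 1)

/-- The degree `p` part of the convolution Lie algebra, that is, of the product over all arities
`n + 1` of the `n`-fold shifted spaces of (series of) admissible graphs: a graph of degree `d` and
arity `n + 1` has degree `d + n` here. -/
noncomputable def convolution (K : Type*) [Field K] (p : ℤ) : Submodule K (Family K) where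
  carrier := {x | ∀ n m : ℕ, x n m ∈ dgraphs K (n + 1) m (p - n)}
  add_mem' hx hy := fun n m => Submodule.add_mem _ (hx n m) (hy n m)
  zero_mem' := fun _ _ => Submodule.zero_mem _
  smul_mem' c _ hx := fun n m => Submodule.smul_mem _ c (hx n m)

/-- The pre-Lie product `x ⋆ y`, where `y` has degree `q`. In arities `n = p.1.1 + 1` of `x` and
`m = p.1.2 + 1` of `y` it is the sum over `i = 1, ..., n` of
`(-1) ^ (|y| * (1 - n) + (i + 1) * (m - 1))` times `x ∘ᵢ y`, where `|y| = q - (m - 1)` is the degree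
of the graphs in `y`. -/
noncomputable def preLieMul (K : Type*) [Field K] (q : ℤ) (x y : Family K) : Family K :=
  fun N M => ∑ p : Finset.HasAntidiagonal.antidiagonal N, ∑ i : Fin (p.1.1 + 1),
    ((-1 : K) ^ ((q - p.1.2) * (1 - ((p.1.1 : ℤ) + 1)) + (((i : ℤ) + 1) + 1) * p.1.2)) •
      seriesComp K (Finset.HasAntidiagonal.mem_antidiagonal.1 p.2) i (x p.1.1) (y p.1.2) M

/-- The graded commutator `[x, y]` of an element `x` of degree `p` and an element `y` of degree
`q`. -/
noncomputable def bracket (K : Type*) [Field K] (p q : ℤ) (x y : Family K) : Family K :=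
  preLieMul K q x y - ((-1 : K) ^ (p * q)) • preLieMul K p y x

/-- Gauge equivalence of degree one elements: `β = exp (ad ξ) α` for some `ξ` of degree zero. The
exponential series is required to converge in the complete topology of formal series, that is, in
each component (given numbers of external and internal vertices) its partial sums are eventually
constant. -/
def GaugeEquiv (K : Type*) [Field K] (α β : Family K) : Prop :=
  ∃ ξ ∈ convolution K 0, ∀ n m : ℕ, ∃ B : ℕ, ∀ b ≥ B,
    (∑ k ∈ Finset.range b, ((k.factorial : K)⁻¹) • (bracket K 0 1 ξ)^[k] α) n m = β n m

/-! ### The two elements -/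

/-- The element of the convolution Lie algebra with components `a` in arity one, `b` in arity two,
and zero in all higher arities. -/
noncomputable def strictElement (K : Type*) [Field K] (a : Series K 1) (b : Series K 2) : Family K
  | 0 => a
  | 1 => b
  | _ + 2 => 0

/-- The Chevalley-Eilenberg differential: the sum of the two graphs with one external and one
internal vertex and a single edge between them. -/
noncomputable def differential (K : Type*) [Field K] : Series K 1
  | 1 => Submodule.Quotient.mk (edge K (Sum.inr 0) (Sum.inl 0) + edge K (Sum.inl 0) (Sum.inr 0))
  | _ => 0

/-- The commutative product: the graph with two external vertices and nothing else. -/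
noncomputable def commProduct (K : Type*) [Field K] : Series K 2
  | 0 => Submodule.Quotient.mk 1
  | _ => 0

/-- The coefficient of the word `w` in `e^X e^Y`, where the letters `0`, `1` stand for the
non-commuting variables `X`, `Y`. -/
def expCoeff (w : List (Fin 2)) : ℚ :=
  if w = List.replicate (w.count 0) 0 ++ List.replicate (w.count 1) 1 then
    1 / ((w.count 0).factorial * (w.count 1).factorial)
  else 0

/-- The coefficient of the word `w` in `(e^X e^Y - 1) ^ r`. -/
def powCoeff : ℕ → List (Fin 2) → ℚ
  | 0, w => if w = [] then 1 else 0
  | r + 1, w => ∑ k ∈ Finset.Icc 1 w.length, expCoeff (w.take k) * powCoeff r (w.drop k)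

/-- The coefficient of the word `w` in the Baker-Campbell-Hausdorff series `log (e^X e^Y)`. -/
def bchCoeff (w : List (Fin 2)) : ℚ :=
  ∑ r ∈ Finset.Icc 1 w.length, (-1) ^ (r - 1) / (r : ℚ) * powCoeff r w

/-- The tree of the iterated bracket `[w₀, [w₁, ..., [w_{m-1}, w_m]]]` of two external vertices: an
internal vertex with outgoing edges to `a`, `b` (in this order) is the bracket `[a, b]`, and its
incoming edge, if any, comes from the bracket into which `[a, b]` is inserted. -/
noncomputable def bracketTree (K : Type*) [Field K] {m : ℕ} (w : Fin (m + 1) → Fin 2) :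
    GraphAlg K 2 m :=
  graph K ((List.finRange m).flatMap fun k =>
    [(Sum.inr k, Sum.inl (w k.castSucc)),
      (Sum.inr k, if h : k.1 + 1 < m then Sum.inr ⟨k.1 + 1, h⟩ else Sum.inl (w (Fin.last m)))])

/-- `log (e^X e^Y) - X - Y` as a series of trees, by the formula of Dynkin: the Lie series is
obtained from the series of words by replacing each word of length `m + 1` by `1 / (m + 1)` times
its iterated bracket. -/
noncomputable def bchTrees (K : Type*) [Field K] (m : ℕ) : GraphAlg K 2 m :=
  if m = 0 then 0
  else ∑ w : Fin (m + 1) → Fin 2,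
    ((bchCoeff (List.ofFn w) / ((m : ℚ) + 1) : ℚ) : K) • bracketTree K w

/-- Superposition of graphs: the external vertices are shared, the internal vertices and the edges
are those of both graphs. -/
noncomputable def superpose (K : Type*) [Field K] {n m₁ m₂ M : ℕ} (hM : m₁ + m₂ = M)
    (x : GraphAlg K n m₁) (y : GraphAlg K n m₂) : GraphAlg K n M :=
  reconnect K (fun a => {Sum.map id (fun u : Fin m₁ => (⟨u, by omega⟩ : Fin M)) a}) x *
    reconnect K (fun a => {Sum.map id (fun u : Fin m₂ => (⟨m₁ + u, by omega⟩ : Fin M)) a}) y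

/-- The powers of `bchTrees` for superposition. -/
noncomputable def bchPow (K : Type*) [Field K] : ℕ → (M : ℕ) → GraphAlg K 2 M
  | 0, M => if M = 0 then 1 else 0
  | j + 1, M => ∑ r : Finset.HasAntidiagonal.antidiagonal M,
      superpose K (Finset.HasAntidiagonal.mem_antidiagonal.1 r.2) (bchTrees K r.1.1) (bchPow K j r.1.2)

/-- The product on `Sg` that is pulled back from `Ug` by the symmetrization map: the bidifferential
operator with symbol `exp ⟨x, log (e^X e^Y) - X - Y⟩`, that is, the exponential of `bchTrees` for
superposition. -/
noncomputable def symProduct (K : Type*) [Field K] : Series K 2 :=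
  fun M => ∑ j ∈ Finset.range (M + 1),
    ((j.factorial : K)⁻¹) • (Submodule.Quotient.mk (bchPow K j M) : GraphQuot K 2 M)

/-- The wheel with `m` spokes, i.e. the symbol `tr (ad_x ^ m)`: a directed cycle of internal
vertices, each of which has one outgoing edge to the external vertex and one to the next internal
vertex. -/
noncomputable def wheel (K : Type*) [Field K] (m : ℕ) : GraphAlg K 1 m :=
  graph K ((List.finRange m).flatMap fun k =>
    [(Sum.inr k, Sum.inl 0), (Sum.inr k, Sum.inr ⟨(k.1 + 1) % m, Nat.mod_lt _ k.pos⟩)])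

/-- `s * log J^(1/2)` as a series of wheels, where
`J(x) = det ((e^(ad_x/2) - e^(-ad_x/2)) / ad_x)`, so that `log J^(1/2)(x)` is the sum over even
`m ≥ 2` of `B_m / (2 * m * m!) * tr (ad_x ^ m)`, with the Bernoulli numbers `B_m` (which vanish for
odd `m ≥ 3`). -/
noncomputable def wheelSeries (K : Type*) [Field K] (s : ℚ) : Series K 1 :=
  fun m => if 2 ≤ m then
    ((s * (bernoulli m / (2 * m * m.factorial)) : ℚ) : K) • Submodule.Quotient.mk (wheel K m)
  else 0

/-- The powers of `wheelSeries` for composition. -/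
noncomputable def wheelPow (K : Type*) [Field K] (s : ℚ) : ℕ → Series K 1
  | 0 => fun M => if M = 0 then Submodule.Quotient.mk 1 else 0
  | j + 1 => seriesComp K (n₁ := 0) (n₂ := 0) rfl 0 (wheelSeries K s) (wheelPow K s j)

/-- The differential operator `J^(s/2)` of infinite order with constant coefficients. -/
noncomputable def dufloFactor (K : Type*) [Field K] (s : ℚ) : Series K 1 :=
  fun M => ∑ j ∈ Finset.range (M + 1), ((j.factorial : K)⁻¹) • wheelPow K s j M

/-- The product that is pulled back from `Ug` by the Duflo map `Duf = Sym ∘ J^(1/2)`, that is,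
`Duf⁻¹ ∘ m_U ∘ (Duf ⊗ Duf) = J^(-1/2) ∘ symProduct ∘ (J^(1/2) ⊗ J^(1/2))`. -/
noncomputable def dufloProduct (K : Type*) [Field K] : Series K 2 :=
  seriesComp K (n₁ := 0) (n₂ := 1) rfl 0 (dufloFactor K (-1))
    (seriesComp K (n₁ := 1) (n₂ := 0) rfl 0
      (seriesComp K (n₁ := 1) (n₂ := 0) rfl 1 (symProduct K) (dufloFactor K 1))
      (dufloFactor K 1))

/-- The element that encodes the differential and the commutative product. -/
noncomputable def alphaZero (K : Type*) [Field K] : Family K :=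
  strictElement K (differential K) (commProduct K)

/-- The element that encodes the differential and the product induced by the Duflo map. -/
noncomputable def alphaDuf (K : Type*) [Field K] : Family K :=
  strictElement K (differential K) (dufloProduct K)

end DufloGraph

/-!
Only graphs with at most four external vertices and at most one internal vertex matter. The
component of a gauge transformation `ξ` with one external and no internal vertex is a multiple of
the operadic unit; it vanishes, since otherwise the exponential series diverges. Hence `ad_ξ` raises
the weight `(arity - 1) + #{internal vertices}`, and every component of the gauge equation is a
finite sum.

Let two products have the constant term `a₂`, and let `c` and `c'` be their coefficients at the tree
that represents the bracket. Let `y`, `z` and `w` be the components of `ξ` with two external, with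
three external, and with two external and one internal vertex. The gauge equation gives
`[y, a₁] = (c' - c) tree`, up to a bracket with `a₂` in which the tree does not occur,
`[z, a₂] = 0`, and `[y, (c + c') tree] + 2 [w, a₂] + 2 [z, a₁] = 0`. The alternating sum of the
coefficients of the corollas with one incoming and two outgoing edges vanishes on `[w, a₂]`, and
also on `[z, a₁]`, because `z` is a cocycle. On `[y, tree]` it is `-2` times the coefficient of the
tree in `[y, a₁]`, so `c ^ 2 = c' ^ 2`. However, `c = 1 / 2` for the Duflo product and `c' = 0` for
the commutative one.
-/

namespace DufloGraph

section Coefficients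

variable (K : Type*) [Field K] {n m n' m' k : ℕ}

/-- The linear form on the exterior algebra of `K ^ k` that is the determinant on products of `k`
vectors and vanishes in all other degrees. -/
noncomputable def detForm (k : ℕ) : ExteriorAlgebra K (Fin k → K) →ₗ[K] K :=
  ExteriorAlgebra.liftAlternating
    (Pi.single (M := fun i => (Fin k → K) [⋀^Fin i]→ₗ[K] K) k Matrix.detRowAlternating)

/-- The coordinate of a combination of edges at the edge `e`. It is zero if `e` is a simple loop,
because graphs with simple loops are zero. -/
noncomputable def edgeCoord (e : Vtx n m × Vtx n m) : EdgeSpace K n m →ₗ[K] K :=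
  if e.1 = e.2 then 0 else Finsupp.lapply e

/-- The coordinates of a combination of edges at the edges `E j`. -/
noncomputable def edgeCoords (E : Fin k → Vtx n m × Vtx n m) : EdgeSpace K n m →ₗ[K] (Fin k → K) :=
  LinearMap.pi fun j => edgeCoord K (E j)

/-- The coefficient of the graph with edges `E 0 < ... < E (k - 1)`. -/
noncomputable def graphCoeff (E : Fin k → Vtx n m × Vtx n m) : GraphAlg K n m →ₗ[K] K :=
  detForm K k ∘ₗ (ExteriorAlgebra.map (edgeCoords K E)).toLinearMap

variable {K}

theorem detForm_ιMulti_self (w : Fin k → Fin k → K) :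
    detForm K k (ExteriorAlgebra.ιMulti K k w) = Matrix.det (Matrix.of w) := by
  rw [detForm, ExteriorAlgebra.liftAlternating_apply_ιMulti, Pi.single_eq_same]
  rfl

theorem detForm_ιMulti_of_ne {l : ℕ} (h : l ≠ k) (w : Fin l → Fin k → K) :
    detForm K k (ExteriorAlgebra.ιMulti K l w) = 0 := by
  rw [detForm, ExteriorAlgebra.liftAlternating_apply_ιMulti, Pi.single_eq_of_ne h,
    AlternatingMap.zero_apply]

theorem detForm_one : detForm K 0 1 = 1 := by
  rw [← ExteriorAlgebra.ιMulti_zero_apply (R := K) (v := ![]), detForm_ιMulti_self,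
    Matrix.det_isEmpty]

theorem detForm_ι_mul (v : Fin (k + 1) → K) (x : ExteriorAlgebra K (Fin (k + 1) → K)) :
    detForm K (k + 1) (ExteriorAlgebra.ι K v * x) = ∑ j : Fin (k + 1), (-1) ^ (j : ℕ) * v j *
      detForm K k (ExteriorAlgebra.map (LinearMap.funLeft K K j.succAbove) x) := by
  suffices detForm K (k + 1) ∘ₗ LinearMap.mulLeft K (ExteriorAlgebra.ι K v) =
      ∑ j : Fin (k + 1), ((-1) ^ (j : ℕ) * v j) • detForm K k ∘ₗ
        (ExteriorAlgebra.map (LinearMap.funLeft K K j.succAbove)).toLinearMap by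
    simpa using LinearMap.congr_fun this x
  refine ExteriorAlgebra.lhom_ext fun l => AlternatingMap.ext fun w => ?_
  have hcons : ExteriorAlgebra.ι K v * ExteriorAlgebra.ιMulti K l w =
      ExteriorAlgebra.ιMulti K (l + 1) (Matrix.vecCons v w) := by
    rw [ExteriorAlgebra.ιMulti_succ_apply]
    rfl
  simp only [LinearMap.compAlternatingMap_apply, LinearMap.comp_apply, LinearMap.mulLeft_apply,
    LinearMap.sum_apply, LinearMap.smul_apply, AlgHom.toLinearMap_apply, smul_eq_mul, hcons,
    ExteriorAlgebra.map_apply_ιMulti]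
  by_cases hl : l = k
  · subst hl
    simp only [detForm_ιMulti_self]
    rw [Matrix.det_succ_row_zero]
    rfl
  · simp only [detForm_ιMulti_of_ne hl, detForm_ιMulti_of_ne (by omega : l + 1 ≠ k + 1), mul_zero,
      Finset.sum_const_zero]

theorem detForm_map_neg (x : ExteriorAlgebra K (Fin k → K)) :
    detForm K k (ExteriorAlgebra.map (-LinearMap.id) x) = (-1) ^ k * detForm K k x := by
  suffices detForm K k ∘ₗ (ExteriorAlgebra.map (-LinearMap.id)).toLinearMap =
      (-1 : K) ^ k • detForm K k from LinearMap.congr_fun this x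
  refine ExteriorAlgebra.lhom_ext fun l => AlternatingMap.ext fun w => ?_
  simp only [LinearMap.compAlternatingMap_apply, LinearMap.comp_apply, LinearMap.smul_apply,
    AlgHom.toLinearMap_apply, smul_eq_mul, ExteriorAlgebra.map_apply_ιMulti]
  by_cases hl : l = k
  · subst hl
    have hneg : Matrix.of (⇑(-LinearMap.id : (Fin l → K) →ₗ[K] Fin l → K) ∘ w) = -Matrix.of w := rfl
    rw [detForm_ιMulti_self, detForm_ιMulti_self, hneg, Matrix.det_neg, Fintype.card_fin]
  · rw [detForm_ιMulti_of_ne hl, detForm_ιMulti_of_ne hl, mul_zero]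

theorem detForm_map_eq_zero {V : Type*} [AddCommGroup V] [Module K V] {φ : V →ₗ[K] (Fin k → K)}
    (hφ : ∀ w : Fin k → V, Matrix.det (Matrix.of (φ ∘ w)) = 0) (x : ExteriorAlgebra K V) :
    detForm K k (ExteriorAlgebra.map φ x) = 0 := by
  suffices detForm K k ∘ₗ (ExteriorAlgebra.map φ).toLinearMap = 0 from LinearMap.congr_fun this x
  refine ExteriorAlgebra.lhom_ext fun l => AlternatingMap.ext fun w => ?_
  simp only [LinearMap.compAlternatingMap_apply, LinearMap.comp_apply, AlgHom.toLinearMap_apply,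
    ExteriorAlgebra.map_apply_ιMulti]
  by_cases hl : l = k
  · subst hl
    exact (detForm_ιMulti_self _).trans (hφ w)
  · exact detForm_ιMulti_of_ne hl _

theorem edgeCoord_single (e : Vtx n m × Vtx n m) (a b : Vtx n m) :
    edgeCoord K e (Finsupp.single (a, b) 1) = if a ≠ b ∧ e = (a, b) then 1 else 0 := by
  rw [edgeCoord]
  split_ifs with hloop h h
  · obtain ⟨hab, rfl⟩ := h
    exact absurd hloop hab
  · rfl
  · simp [h.2]
  · refine Finsupp.single_eq_of_ne fun he => h ⟨fun hab => hloop ?_, he⟩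
    rw [he, hab]

theorem graphCoeff_apply (E : Fin k → Vtx n m × Vtx n m) (x : GraphAlg K n m) :
    graphCoeff K E x = detForm K k (ExteriorAlgebra.map (edgeCoords K E) x) := rfl

theorem graphCoeff_one (E : Fin 0 → Vtx n m × Vtx n m) : graphCoeff K E 1 = 1 := by
  rw [graphCoeff_apply, map_one, detForm_one]

theorem graphCoeff_ι_mul (E : Fin (k + 1) → Vtx n m × Vtx n m) (v : EdgeSpace K n m)
    (x : GraphAlg K n m) :
    graphCoeff K E (ExteriorAlgebra.ι K v * x) = ∑ j : Fin (k + 1),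
      (-1) ^ (j : ℕ) * edgeCoord K (E j) v * graphCoeff K (E ∘ j.succAbove) x := by
  rw [graphCoeff_apply, map_mul, ExteriorAlgebra.map_apply_ι, detForm_ι_mul]
  refine Finset.sum_congr rfl fun j _ => ?_
  rw [graphCoeff_apply, ← AlgHom.comp_apply, ExteriorAlgebra.map_comp_map]
  rfl

theorem graphCoeff_map_neg (E : Fin k → Vtx n m × Vtx n m) (x : GraphAlg K n m) :
    graphCoeff K E (ExteriorAlgebra.map (-LinearMap.id) x) = (-1) ^ k * graphCoeff K E x := by
  rw [graphCoeff_apply, graphCoeff_apply, ← detForm_map_neg, ← AlgHom.comp_apply,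
    ← AlgHom.comp_apply, ExteriorAlgebra.map_comp_map, ExteriorAlgebra.map_comp_map,
    LinearMap.comp_neg, LinearMap.neg_comp, LinearMap.comp_id, LinearMap.id_comp]

theorem graphCoeff_mul_edge (E : Fin (k + 1) → Vtx n m × Vtx n m) (x : GraphAlg K n m)
    (a b : Vtx n m) :
    graphCoeff K E (x * edge K a b) = ∑ j : Fin (k + 1), (-1) ^ (k + j : ℕ) *
      (if a ≠ b ∧ E j = (a, b) then 1 else 0) * graphCoeff K (E ∘ j.succAbove) x := by
  have hinv : ExteriorAlgebra.map (-LinearMap.id) (ExteriorAlgebra.map (-LinearMap.id) x) = x := by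
    have hid : (-LinearMap.id) ∘ₗ (-LinearMap.id) = (LinearMap.id : EdgeSpace K n m →ₗ[K] _) :=
      LinearMap.ext fun v => neg_neg v
    rw [← AlgHom.comp_apply, ExteriorAlgebra.map_comp_map, hid, ExteriorAlgebra.map_id,
      AlgHom.id_apply]
  nth_rewrite 1 [← hinv]
  rw [← edge_mul, edge, graphCoeff_ι_mul]
  refine Finset.sum_congr rfl fun j _ => ?_
  rw [edgeCoord_single, graphCoeff_map_neg, pow_add]
  ring

theorem graphCoeff_eq_zero_of_eq {E : Fin k → Vtx n m × Vtx n m} {i j : Fin k} (hij : i ≠ j)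
    (h : E i = E j) (x : GraphAlg K n m) : graphCoeff K E x = 0 := by
  refine detForm_map_eq_zero (fun w => Matrix.det_zero_of_column_eq hij fun l => ?_) x
  simp [edgeCoords, h]

theorem edgeCoord_reconnectEdge_single (f : Vtx n m → Finset (Vtx n' m'))
    (e : Vtx n' m' × Vtx n' m') (a b : Vtx n m) :
    edgeCoord K e (reconnectEdge K f (Finsupp.single (a, b) 1)) =
      if a ≠ b ∧ e.1 ≠ e.2 ∧ e.1 ∈ f a ∧ e.2 ∈ f b then 1 else 0 := by
  rw [reconnectEdge, Finsupp.linearCombination_single, one_smul]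
  by_cases hab : a = b
  · simp [hab]
  by_cases he : e.1 = e.2
  · simp [edgeCoord, he]
  · rw [if_neg hab, ← Finset.sum_product', edgeCoord, if_neg he, Finsupp.lapply_apply,
      Finsupp.finsetSum_apply]
    simp only [Finsupp.single_apply]
    rw [Finset.sum_ite_eq' (f a ×ˢ f b) e]
    simp [hab, he]

theorem graphCoeff_reconnect {f : Vtx n m → Finset (Vtx n' m')} {π : Vtx n' m' → Vtx n m}
    (hπ : ∀ a c, c ∈ f a ↔ π c = a) (E : Fin k → Vtx n' m' × Vtx n' m') (x : GraphAlg K n m) :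
    graphCoeff K E (reconnect K f x) = graphCoeff K (Prod.map π π ∘ E) x := by
  have hcoords : edgeCoords K E ∘ₗ reconnectEdge K f = edgeCoords K (Prod.map π π ∘ E) := by
    refine Finsupp.lhom_ext' fun ⟨a, b⟩ => LinearMap.ext_ring <| funext fun j => ?_
    refine (edgeCoord_reconnectEdge_single f (E j) a b).trans (.trans ?_
      (edgeCoord_single (Prod.map π π (E j)) a b).symm)
    refine if_congr ?_ rfl rfl
    simp only [hπ, Prod.ext_iff, Prod.map_fst, Prod.map_snd]
    grind
  rw [graphCoeff_apply, graphCoeff_apply, reconnect, ← AlgHom.comp_apply,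
    ExteriorAlgebra.map_comp_map, hcoords]

theorem graphCoeff_reconnect_eq_zero {f : Vtx n m → Finset (Vtx n' m')}
    {E : Fin k → Vtx n' m' × Vtx n' m'} {j : Fin k}
    (hj : ∀ a b, (E j).1 ∈ f a → (E j).2 ∉ f b) (x : GraphAlg K n m) :
    graphCoeff K E (reconnect K f x) = 0 := by
  have hcoord : edgeCoord K (E j) ∘ₗ reconnectEdge K f = 0 := by
    refine Finsupp.lhom_ext' fun ⟨a, b⟩ => LinearMap.ext_ring ?_
    refine (edgeCoord_reconnectEdge_single f (E j) a b).trans (if_neg ?_)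
    exact fun h => hj a b h.2.2.1 h.2.2.2
  rw [graphCoeff_apply, reconnect, ← AlgHom.comp_apply, ExteriorAlgebra.map_comp_map]
  refine detForm_map_eq_zero (fun w => Matrix.det_eq_zero_of_column_eq_zero j fun l => ?_) x
  exact LinearMap.congr_fun hcoord (w l)

/-- No internal vertex has two incoming or three outgoing edges among the edges `E j`. -/
abbrev InternallyTrivalent (E : Fin k → Vtx n m × Vtx n m) : Prop :=
  (∀ (v : Fin m) i j, (E i).2 = Sum.inr v → (E j).2 = Sum.inr v → E i = E j) ∧
  ∀ (v : Fin m) i j l, (E i).1 = Sum.inr v → (E j).1 = Sum.inr v → (E l).1 = Sum.inr v →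
    E i = E j ∨ E i = E l ∨ E j = E l

theorem exists_eq_of_map_edge_ne_zero {E : Fin k → Vtx n m × Vtx n m} {a b : Vtx n m}
    (h : ExteriorAlgebra.map (edgeCoords K E) (edge K a b) ≠ 0) : ∃ j, E j = (a, b) := by
  by_contra! hE
  refine h ?_
  have hzero : edgeCoords K E (Finsupp.single (a, b) 1) = 0 := funext fun j =>
    (edgeCoord_single (E j) a b).trans (if_neg fun hj => hE j hj.2)
  rw [edge, ExteriorAlgebra.map_apply_ι, hzero, map_zero]

theorem edge_mul_self (a b : Vtx n m) : edge K a b * edge K a b = 0 :=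
  ExteriorAlgebra.ι_sq_zero _

theorem edge_mul_swap (a b c d : Vtx n m) : edge K a b * edge K c d = -(edge K c d * edge K a b) :=
  eq_neg_of_add_eq_zero_left (ExteriorAlgebra.ι_add_mul_swap _ _)

theorem map_edgeCoords_incoming {E : Fin k → Vtx n m × Vtx n m} (hE : InternallyTrivalent E)
    (v : Fin m) (a b : Vtx n m) :
    ExteriorAlgebra.map (edgeCoords K E) (edge K a (Sum.inr v) * edge K b (Sum.inr v)) = 0 := by
  by_contra h
  rw [map_mul] at h
  obtain ⟨i, hi⟩ := exists_eq_of_map_edge_ne_zero (left_ne_zero_of_mul h)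
  obtain ⟨j, hj⟩ := exists_eq_of_map_edge_ne_zero (right_ne_zero_of_mul h)
  obtain rfl : a = b := congrArg Prod.fst
    ((hi.symm.trans (hE.1 v i j (congrArg Prod.snd hi) (congrArg Prod.snd hj))).trans hj)
  rw [← map_mul, edge_mul_self, map_zero] at h
  exact h rfl

theorem map_edgeCoords_outgoing {E : Fin k → Vtx n m × Vtx n m} (hE : InternallyTrivalent E)
    (v : Fin m) (a b c : Vtx n m) :
    ExteriorAlgebra.map (edgeCoords K E)
      (edge K (Sum.inr v) a * edge K (Sum.inr v) b * edge K (Sum.inr v) c) = 0 := by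
  by_contra h
  rw [map_mul, map_mul] at h
  obtain ⟨i, hi⟩ := exists_eq_of_map_edge_ne_zero (left_ne_zero_of_mul (left_ne_zero_of_mul h))
  obtain ⟨j, hj⟩ := exists_eq_of_map_edge_ne_zero (right_ne_zero_of_mul (left_ne_zero_of_mul h))
  obtain ⟨l, hl⟩ := exists_eq_of_map_edge_ne_zero (right_ne_zero_of_mul h)
  rw [← map_mul, ← map_mul] at h
  have hcases := hE.2 v i j l (congrArg Prod.fst hi) (congrArg Prod.fst hj) (congrArg Prod.fst hl)
  simp only [hi, hj, hl, Prod.mk.injEq, true_and] at hcases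
  rcases hcases with rfl | rfl | rfl
  · rw [edge_mul_self, zero_mul, map_zero] at h
    exact h rfl
  · rw [edge_mul_swap, neg_mul, mul_assoc, edge_mul_self, mul_zero, neg_zero, map_zero] at h
    exact h rfl
  · rw [mul_assoc, edge_mul_self, mul_zero, map_zero] at h
    exact h rfl

theorem map_edgeCoords_loop (E : Fin k → Vtx n m × Vtx n m) (a : Vtx n m) :
    ExteriorAlgebra.map (edgeCoords K E) (edge K a a) = 0 := by
  have hzero : edgeCoords K E (Finsupp.single (a, a) 1) = 0 := funext fun j =>
    (edgeCoord_single (E j) a a).trans (if_neg fun hj => hj.1 rfl)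
  rw [edge, ExteriorAlgebra.map_apply_ι, hzero, map_zero]

theorem graphCoeff_mul_mul_eq_zero {E : Fin k → Vtx n m × Vtx n m} {y : GraphAlg K n m}
    (hy : ExteriorAlgebra.map (edgeCoords K E) y = 0) (x z : GraphAlg K n m) :
    graphCoeff K E (x * y * z) = 0 := by
  rw [graphCoeff_apply, map_mul (ExteriorAlgebra.map _), map_mul (ExteriorAlgebra.map _), hy,
    mul_zero, zero_mul, map_zero]

/-- If there is at most one internal vertex, there are no IHX relations. -/
theorem graphCoeff_of_rel [Subsingleton (Fin m)] {E : Fin k → Vtx n m × Vtx n m}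
    (hE : InternallyTrivalent E) {x : GraphAlg K n m} (hx : Rel K n m x) :
    graphCoeff K E x = 0 := by
  cases hx with
  | loop x y a => exact graphCoeff_mul_mul_eq_zero (map_edgeCoords_loop E a) x y
  | incoming x y v a b => exact graphCoeff_mul_mul_eq_zero (map_edgeCoords_incoming hE v a b) x y
  | outgoing x y v a b c =>
    exact graphCoeff_mul_mul_eq_zero (map_edgeCoords_outgoing hE v a b c) x y
  | relabel x σ =>
    have hσ : (Sum.map id σ : Vtx n m → Vtx n m) = id := by
      rw [Subsingleton.elim σ 1, Equiv.Perm.coe_one, Sum.map_id_id]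
    rw [map_sub, sub_eq_zero, hσ, graphCoeff_reconnect (π := id) (by simp), Prod.map_id,
      Function.id_comp]
  | ihx x w v => exact absurd (Subsingleton.elim (w.succAbove v) w) (Fin.succAbove_ne w v)

variable (K) in
/-- The coefficient of the graph with edges `E 0 < ... < E (k - 1)` in a combination of graphs
modulo relations. -/
noncomputable def coeff [Subsingleton (Fin m)] (E : Fin k → Vtx n m × Vtx n m)
    (hE : InternallyTrivalent E) : GraphQuot K n m →ₗ[K] K :=
  (relations K n m).liftQ (graphCoeff K E)
    (Submodule.span_le.2 fun _ hx => graphCoeff_of_rel hE hx)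

theorem coeff_mk [Subsingleton (Fin m)] (E : Fin k → Vtx n m × Vtx n m)
    (hE : InternallyTrivalent E) (x : GraphAlg K n m) :
    coeff K E hE (Submodule.Quotient.mk x) = graphCoeff K E x := rfl

end Coefficients

section Brackets

open Finset.HasAntidiagonal (antidiagonal mem_antidiagonal)

variable (K : Type*) [Field K] {n n₁ n₂ m₁ m₂ N M : ℕ}

/-- The pre-Lie product of single components, where the right factor belongs to an element of
degree `q`. -/
noncomputable def preLieComponent (q : ℤ) (hN : n₁ + n₂ = N) (hM : m₁ + m₂ = M) :
    GraphQuot K (n₁ + 1) m₁ →ₗ[K] GraphQuot K (n₂ + 1) m₂ →ₗ[K] GraphQuot K (N + 1) M :=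
  ∑ i : Fin (n₁ + 1),
    ((-1 : K) ^ ((q - n₂) * (1 - ((n₁ : ℤ) + 1)) + (((i : ℤ) + 1) + 1) * n₂)) • comp K hN hM i

/-- The bracket of single components of an element of degree zero and an element of degree one. -/
noncomputable def bracketComponent (hN : n₁ + n₂ = N) (hM : m₁ + m₂ = M) :
    GraphQuot K (n₁ + 1) m₁ →ₗ[K] GraphQuot K (n₂ + 1) m₂ →ₗ[K] GraphQuot K (N + 1) M :=
  preLieComponent K 1 hN hM -
    (preLieComponent K 0 ((Nat.add_comm n₂ n₁).trans hN) ((Nat.add_comm m₂ m₁).trans hM)).flip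

variable {K}

theorem bracketComponent_binary (hN : n + 1 = N) (hM : m₁ + m₂ = M) (x : GraphQuot K (n + 1) m₁)
    (y : GraphQuot K 2 m₂) :
    bracketComponent K hN hM x y = ∑ i : Fin (n + 1), (-1 : K) ^ (i : ℕ) • comp K hN hM i x y -
      (-1 : K) ^ n • comp K ((Nat.add_comm 1 n).trans hN) ((Nat.add_comm m₂ m₁).trans hM) 0 y x -
      comp K ((Nat.add_comm 1 n).trans hN) ((Nat.add_comm m₂ m₁).trans hM) 1 y x := by
  have hright (i : Fin (n + 1)) : (-1 : K) ^ (((1 : ℤ) - (1 : ℕ)) * (1 - ((n : ℤ) + 1)) +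
      (((i : ℤ) + 1) + 1) * (1 : ℕ)) = (-1) ^ (i : ℕ) := by
    rw [Nat.cast_one, sub_self, zero_mul, zero_add, mul_one, add_assoc, zpow_add₀ (by simp)]
    simp
  have hleft : (-1 : K) ^ (((0 : ℤ) - n) * (1 - (((1 : ℕ) : ℤ) + 1)) + ((0 + 1) + 1) * n) =
      (-1) ^ n := by
    have hexp : ((0 : ℤ) - n) * (1 - (((1 : ℕ) : ℤ) + 1)) + ((0 + 1) + 1) * n = n + 2 * n := by
      push_cast
      ring
    rw [hexp, zpow_add₀ (by simp), zpow_mul]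
    simp
  have hleft' : (-1 : K) ^ (((0 : ℤ) - n) * (1 - (((1 : ℕ) : ℤ) + 1)) + ((1 + 1) + 1) * n) = 1 := by
    have hexp : ((0 : ℤ) - n) * (1 - (((1 : ℕ) : ℤ) + 1)) + ((1 + 1) + 1) * n = 2 * (2 * n) := by
      push_cast
      ring
    rw [hexp, zpow_mul]
    simp
  simp only [bracketComponent, preLieComponent, LinearMap.sub_apply, LinearMap.flip_apply,
    LinearMap.sum_apply, LinearMap.smul_apply, hright]
  rw [Fin.sum_univ_two, sub_sub]
  simp only [Fin.val_zero, Fin.val_one, Nat.cast_zero, Nat.cast_one] at hleft hleft' ⊢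
  rw [hleft, hleft', one_smul]

theorem bracketComponent_unary (hM : m₁ + m₂ = M) (x : GraphQuot K (n + 1) m₁)
    (y : GraphQuot K 1 m₂) :
    bracketComponent K (add_zero n) hM x y =
      (-1 : K) ^ n • ∑ i : Fin (n + 1), comp K (add_zero n) hM i x y -
      comp K (zero_add n) ((Nat.add_comm m₂ m₁).trans hM) 0 y x := by
  have hinv : ((-1 : K) ^ n)⁻¹ = (-1) ^ n := by rw [← inv_pow, inv_neg, inv_one]
  simp [bracketComponent, preLieComponent, Finset.smul_sum, hinv, zpow_mul]

theorem sum_antidiagonal_coe {A : Type*} [AddCommMonoid A] (F : antidiagonal N → A) :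
    ∑ p, F p =
      ∑ k : Fin (N + 1), F ⟨(k, N - k), mem_antidiagonal.2 (Nat.add_sub_cancel' k.is_le)⟩ :=
  ((Finset.Nat.antidiagonalEquivFin N).symm.sum_comp F).symm

/-- Interchanging the two entries of the pairs with sum `N`. -/
def antidiagonalSwap (N : ℕ) : Equiv.Perm (antidiagonal N) :=
  (Equiv.prodComm ℕ ℕ).subtypeEquiv fun p => by simp [Nat.add_comm]

theorem preLieMul_apply (q : ℤ) (x y : Family K) (N M : ℕ) :
    preLieMul K q x y N M = ∑ p : antidiagonal N, ∑ r : antidiagonal M,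
      preLieComponent K q (mem_antidiagonal.1 p.2) (mem_antidiagonal.1 r.2)
        (x p.1.1 r.1.1) (y p.1.2 r.1.2) := by
  unfold preLieMul
  refine Finset.sum_congr rfl fun p _ => ?_
  simp only [preLieComponent, LinearMap.sum_apply, LinearMap.smul_apply, seriesComp,
    Finset.smul_sum]
  rw [Finset.sum_comm]

theorem preLieMul_apply_swap (q : ℤ) (x y : Family K) (N M : ℕ) :
    preLieMul K q y x N M = ∑ p : antidiagonal N, ∑ r : antidiagonal M,
      preLieComponent K q ((Nat.add_comm _ _).trans (mem_antidiagonal.1 p.2))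
        ((Nat.add_comm _ _).trans (mem_antidiagonal.1 r.2)) (y p.1.2 r.1.2) (x p.1.1 r.1.1) := by
  rw [preLieMul_apply, ← Equiv.sum_comp (antidiagonalSwap N)]
  refine Finset.sum_congr rfl fun p _ => ?_
  rw [← Equiv.sum_comp (antidiagonalSwap M)]
  rfl

theorem bracket_apply (x y : Family K) (N M : ℕ) :
    bracket K 0 1 x y N M = ∑ k : Fin (N + 1), ∑ l : Fin (M + 1),
      bracketComponent K (n₁ := k) (n₂ := N - k) (m₁ := l) (m₂ := M - l) (by omega) (by omega)
        (x k l) (y (N - k) (M - l)) := by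
  have hbracket : bracket K 0 1 x y N M = preLieMul K 1 x y N M - preLieMul K 0 y x N M := by
    simp [bracket]
  rw [hbracket, preLieMul_apply, preLieMul_apply_swap]
  simp only [sum_antidiagonal_coe, ← Finset.sum_sub_distrib]
  rfl

end Brackets

section Units

variable {K : Type*} [Field K] {n n₁ n₂ m m₁ m₂ N M : ℕ}

/-- The vertex of the outer graph to which a vertex of a composition belongs: all the vertices of
the graph inserted at the `i`-th external vertex are sent to that vertex. -/
def collapseVtx (hN : n₁ + n₂ = N) (i : Fin (n₁ + 1)) : Vtx (N + 1) M → Vtx (n₁ + 1) m₁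
  | Sum.inl k =>
      if h : k < (i : ℕ) then Sum.inl ⟨k, by omega⟩
      else if k ≤ (i : ℕ) + n₂ then Sum.inl i else Sum.inl ⟨k - n₂, by omega⟩
  | Sum.inr u => if h : u < m₁ then Sum.inr ⟨u, h⟩ else Sum.inl i

theorem inl_mem_image_innerVtx (hN : n₁ + n₂ = N) (hM : m₁ + m₂ = M) (i : Fin (n₁ + 1))
    (l : Fin (N + 1)) :
    Sum.inl l ∈ Finset.univ.image (innerVtx (m₂ := m₂) hN hM i) ↔
      (i : ℕ) ≤ l ∧ (l : ℕ) ≤ i + n₂ := by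
  simp only [Finset.mem_image, Finset.mem_univ, true_and, Sum.exists, innerVtx, Sum.inl.injEq,
    reduceCtorEq, exists_false, or_false, Fin.ext_iff]
  exact ⟨fun ⟨k, hk⟩ => by omega, fun h => ⟨⟨l - i, by omega⟩, Nat.add_sub_cancel' h.1⟩⟩

theorem inr_mem_image_innerVtx (hN : n₁ + n₂ = N) (hM : m₁ + m₂ = M) (i : Fin (n₁ + 1))
    (w : Fin M) :
    Sum.inr w ∈ Finset.univ.image (innerVtx (m₂ := m₂) hN hM i) ↔ m₁ ≤ w := by
  simp only [Finset.mem_image, Finset.mem_univ, true_and, Sum.exists, innerVtx, Sum.inr.injEq,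
    reduceCtorEq, exists_false, false_or, Fin.ext_iff]
  exact ⟨fun ⟨u, hu⟩ => by omega, fun h => ⟨⟨w - m₁, by omega⟩, Nat.add_sub_cancel' h⟩⟩

theorem mem_outerVtx (hN : n₁ + n₂ = N) (hM : m₁ + m₂ = M) (i : Fin (n₁ + 1))
    (a : Vtx (n₁ + 1) m₁) (c : Vtx (N + 1) M) :
    c ∈ outerVtx hN hM i a ↔ collapseVtx hN i c = a := by
  rcases a with k | u
  · rw [outerVtx]
    split_ifs with hlt heq
    · rcases c with l | w <;> grind [collapseVtx]
    · rcases c with l | w <;>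
        simp only [inl_mem_image_innerVtx, inr_mem_image_innerVtx, collapseVtx] <;> grind
    · rcases c with l | w <;> grind [collapseVtx]
  · rcases c with l | w <;> simp only [outerVtx, collapseVtx] <;> grind

theorem graphCoeff_outer {k : ℕ} (hN : n₁ + n₂ = N) (hM : m₁ + m₂ = M) (i : Fin (n₁ + 1))
    (E : Fin k → Vtx (N + 1) M × Vtx (N + 1) M) (x : GraphAlg K (n₁ + 1) m₁) :
    graphCoeff K E (reconnect K (outerVtx (m₂ := m₂) hN hM i) x) =
      graphCoeff K (Prod.map (collapseVtx hN i) (collapseVtx hN i) ∘ E) x :=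
  graphCoeff_reconnect (mem_outerVtx hN hM i) E x

theorem collapseVtx_zero (i : Fin (n + 1)) (c : Vtx (n + 1) m) :
    collapseVtx (add_zero n) i c = c := by
  rcases c with l | w <;> grind [collapseVtx]

theorem mk_reconnect_singleton (x : GraphAlg K n m) :
    (Submodule.Quotient.mk (reconnect K (fun a => {a}) x) : GraphQuot K n m) =
      Submodule.Quotient.mk x := by
  simpa using (Submodule.Quotient.eq _).2 (mem_relations (Rel.relabel x 1))

theorem comp_unit_right (i : Fin (n + 1)) (x : GraphQuot K (n + 1) m) :
    comp K (add_zero n) (add_zero m) i x (Submodule.Quotient.mk 1) = x := by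
  obtain ⟨x, rfl⟩ := Submodule.Quotient.mk_surjective _ x
  have houter : outerVtx (add_zero n) (add_zero m) i = fun a => {a} := by
    funext a
    ext c
    rw [mem_outerVtx, Finset.mem_singleton, collapseVtx_zero]
  rw [comp_mk, map_one, mul_one, houter, mk_reconnect_singleton]

theorem comp_unit_left (x : GraphQuot K (n + 1) m) :
    comp K (zero_add n) (zero_add m) 0 (Submodule.Quotient.mk 1) x = x := by
  obtain ⟨x, rfl⟩ := Submodule.Quotient.mk_surjective _ x
  have hinner (a : Vtx (n + 1) m) : innerVtx (zero_add n) (zero_add m) 0 a = a := by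
    rcases a with k | u <;> simp [innerVtx]
  rw [comp_mk, map_one, one_mul]
  simp only [hinner, mk_reconnect_singleton]

end Units

section DufloProduct

variable (K : Type*) [Field K]

/-- The tree that represents the bracket of the two external vertices. -/
noncomputable def tree : GraphAlg K 2 1 :=
  edge K (Sum.inr 0) (Sum.inl 0) * edge K (Sum.inr 0) (Sum.inl 1)

theorem bracketTree_one (w : Fin 2 → Fin 2) :
    bracketTree K w =
      edge K (Sum.inr 0) (Sum.inl (w 0)) * edge K (Sum.inr 0) (Sum.inl (w 1)) := by
  simp [bracketTree, graph, List.finRange_succ]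

theorem bchTrees_one [CharZero K] : bchTrees K 1 = (1 / 2 : K) • tree K := by
  have hXY : bchCoeff [0, 1] = 1 / 2 := by decide +kernel
  have hYX : bchCoeff [1, 0] = -1 / 2 := by decide +kernel
  rw [bchTrees, if_neg one_ne_zero, ← (finTwoArrowEquiv (Fin 2)).symm.sum_comp,
    Fintype.sum_prod_type]
  simp only [bracketTree_one, Fin.sum_univ_two, finTwoArrowEquiv_symm_apply, Matrix.cons_val_zero,
    Matrix.cons_val_one, edge_mul_self, smul_zero, List.ofFn_succ, List.ofFn_zero,
    Fin.succ_zero_eq_one, hXY, hYX, tree, zero_add, add_zero]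
  rw [edge_mul_swap (Sum.inr 0) (Sum.inl 1), smul_neg, ← neg_smul, ← add_smul]
  congr 1
  push_cast
  norm_num

variable {K}

theorem seriesComp_zero {n₁ n₂ N : ℕ} (hN : n₁ + n₂ = N) (i : Fin (n₁ + 1))
    (x : Series K (n₁ + 1)) (y : Series K (n₂ + 1)) :
    seriesComp K hN i x y 0 = comp K hN rfl i (x 0) (y 0) := by
  rw [seriesComp, sum_antidiagonal_coe, Fin.sum_univ_one]
  rfl

theorem seriesComp_one {n₁ n₂ N : ℕ} (hN : n₁ + n₂ = N) (i : Fin (n₁ + 1))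
    (x : Series K (n₁ + 1)) (y : Series K (n₂ + 1)) :
    seriesComp K hN i x y 1 =
      comp K hN rfl i (x 0) (y 1) + comp K hN rfl i (x 1) (y 0) := by
  rw [seriesComp, sum_antidiagonal_coe, Fin.sum_univ_two]
  rfl

theorem symProduct_zero : symProduct K 0 = Submodule.Quotient.mk 1 := by
  simp [symProduct, bchPow]

theorem symProduct_one [CharZero K] :
    symProduct K 1 = (1 / 2 : K) • Submodule.Quotient.mk (tree K) := by
  have hpow : bchPow K 1 1 = (1 / 2 : K) • tree K := by
    rw [bchPow, sum_antidiagonal_coe]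
    simp only [bchPow]
    simp [superpose, bchTrees_one, tree, reconnect_edge]
  rw [symProduct, Finset.sum_range_succ, Finset.sum_range_one, hpow]
  simp [bchPow]

theorem dufloFactor_zero (s : ℚ) : dufloFactor K s 0 = Submodule.Quotient.mk 1 := by
  simp [dufloFactor, wheelPow]

/-- The wheels have at least two internal vertices. -/
theorem dufloFactor_one (s : ℚ) : dufloFactor K s 1 = 0 := by
  rw [dufloFactor, Finset.sum_range_succ, Finset.sum_range_one, wheelPow, wheelPow, seriesComp_one]
  simp [wheelSeries]

theorem dufloProduct_zero : dufloProduct K 0 = Submodule.Quotient.mk 1 := by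
  simp only [dufloProduct, seriesComp_zero, symProduct_zero, dufloFactor_zero]
  rw [comp_unit_right, comp_unit_right, comp_unit_left]

theorem dufloProduct_one [CharZero K] :
    dufloProduct K 1 = (1 / 2 : K) • Submodule.Quotient.mk (tree K) := by
  simp only [dufloProduct, seriesComp_one, seriesComp_zero, symProduct_zero, symProduct_one,
    dufloFactor_zero, dufloFactor_one, map_zero, LinearMap.zero_apply, zero_add, add_zero]
  rw [comp_unit_right, comp_unit_right, comp_unit_left]

end DufloProduct

section Insertion

variable {K : Type*} [Field K] {k n n₁ n₂ m m₁ m₂ N M : ℕ}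

theorem collapseVtx_binary (i : Fin (n + 1)) :
    (collapseVtx rfl i : Vtx (n + 1 + 1) m → Vtx (n + 1) m) = Sum.map i.predAbove id := by
  funext c
  rcases c with l | w
  · simp only [collapseVtx, Sum.map_inl, Fin.predAbove, Fin.lt_def, Fin.val_castSucc]
    split_ifs <;> simp [Fin.ext_iff] <;> omega
  · simp [collapseVtx]

theorem graphCoeff_ι_mul_eq_zero {E : Fin (k + 1) → Vtx n m × Vtx n m} {x : GraphAlg K n m}
    (h : ∀ j : Fin (k + 1), graphCoeff K (E ∘ j.succAbove) x = 0) (v : EdgeSpace K n m) :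
    graphCoeff K E (ExteriorAlgebra.ι K v * x) = 0 := by
  simp [graphCoeff_ι_mul, h]

theorem graphCoeff_inner_eq_zero (hN : n₁ + n₂ = N) (hM : m₁ + m₂ = M) (i : Fin (n₁ + 1))
    {E : Fin k → Vtx (N + 1) M × Vtx (N + 1) M} {j : Fin k}
    (hj : ∀ a b, E j ≠ (innerVtx hN hM i a, innerVtx hN hM i b))
    (y : GraphAlg K (n₂ + 1) m₂) :
    graphCoeff K E (reconnect K (fun a => {innerVtx hN hM i a}) y) = 0 := by
  refine graphCoeff_reconnect_eq_zero (j := j) (fun a b ha hb => hj a b ?_) y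
  exact Prod.ext (Finset.mem_singleton.1 ha) (Finset.mem_singleton.1 hb)

end Insertion

section Alternation

variable {K : Type*} [Field K]

/-- The signed sum of a function of three arguments over all ways to fill in three distinct
elements. -/
def alternate (F : Fin 3 → Fin 3 → Fin 3 → K) : K :=
  F 0 1 2 - F 0 2 1 + F 1 2 0 - F 1 0 2 + F 2 0 1 - F 2 1 0

theorem alternate_eq_zero {F : Fin 3 → Fin 3 → Fin 3 → K}
    (h : ∀ p q r, p ≠ q → p ≠ r → q ≠ r → F p q r = 0) : alternate F = 0 := by
  simp [alternate, h]

theorem alternate_comp_eq_zero {A : Type*} (F : A → A → A → K) {σ : Fin 3 → A}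
    (hσ : ¬ Function.Injective σ) : alternate (fun p q r => F (σ p) (σ q) (σ r)) = 0 := by
  obtain ⟨a, b, hab, hne⟩ := Function.not_injective_iff.1 hσ
  fin_cases a <;> fin_cases b <;> simp_all [alternate]

theorem alternate_eq_zero_of_cocycle {γ : Fin 3 → Fin 3 → Fin 3 → Fin 3 → K}
    (hγ : ∀ a b c d : Fin 4, [a, b, c, d].Nodup → ∑ i : Fin 3, (-1) ^ (i : ℕ) *
      γ (i.predAbove a) (i.predAbove b) (i.predAbove c) (i.predAbove d) = 0) :
    alternate (fun p q r => γ p p q r) = 0 := by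
  have hsign (a b c d : Fin 4) (h : [a, b, c, d].Nodup) :
      γ (Fin.predAbove 0 a) (Fin.predAbove 0 b) (Fin.predAbove 0 c) (Fin.predAbove 0 d) -
      γ (Fin.predAbove 1 a) (Fin.predAbove 1 b) (Fin.predAbove 1 c) (Fin.predAbove 1 d) +
      γ (Fin.predAbove 2 a) (Fin.predAbove 2 b) (Fin.predAbove 2 c) (Fin.predAbove 2 d) = 0 := by
    simpa [Fin.sum_univ_three, ← sub_eq_add_neg] using hγ a b c d h
  have pred₀ : ∀ a : Fin 4, Fin.predAbove (0 : Fin 3) a = ![0, 0, 1, 2] a := by decide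
  have pred₁ : ∀ a : Fin 4, Fin.predAbove (1 : Fin 3) a = ![0, 1, 1, 2] a := by decide
  have pred₂ : ∀ a : Fin 4, Fin.predAbove (2 : Fin 3) a = ![0, 1, 2, 2] a := by decide
  simp only [pred₀, pred₁, pred₂] at hsign
  unfold alternate
  -- The terms that merge two vertices other than the first two cancel in pairs.
  linear_combination (norm := (simp only [Matrix.cons_val]; ring))
    hsign 0 1 2 3 (by decide) - hsign 0 1 3 2 (by decide) - hsign 0 2 1 3 (by decide) +
      hsign 0 2 3 1 (by decide) + hsign 0 3 1 2 (by decide) - hsign 0 3 2 1 (by decide) +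
      hsign 1 2 0 3 (by decide) - hsign 1 2 3 0 (by decide) - hsign 1 3 0 2 (by decide) +
      hsign 1 3 2 0 (by decide) + hsign 2 3 0 1 (by decide) - hsign 2 3 1 0 (by decide)

end Alternation

section SmallGraphs

variable {K : Type*} [Field K] {n m : ℕ} {a b : Vtx n m}

theorem graphCoeff_single_edge (hab : a ≠ b) (e : Vtx n m × Vtx n m) :
    graphCoeff K ![e] (edge K a b) = if e = (a, b) then 1 else 0 := by
  rw [← one_mul (edge K a b), graphCoeff_mul_edge]
  simp [hab, graphCoeff_one, -Finset.sum_boole]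

theorem graphCoeff_pair_mul_edge (hab : a ≠ b) (e f : Vtx n m × Vtx n m) (x : GraphAlg K n m) :
    graphCoeff K ![e, f] (x * edge K a b) =
      (if f = (a, b) then graphCoeff K ![e] x else 0) -
        if e = (a, b) then graphCoeff K ![f] x else 0 := by
  have hdel₀ : ![e, f] ∘ Fin.succ = ![f] := rfl
  have hdel₁ : ![e, f] ∘ Fin.succAbove 1 = ![e] := by
    funext j
    fin_cases j
    rfl
  rw [graphCoeff_mul_edge, Fin.sum_univ_two, add_comm]
  simp [hab, hdel₀, hdel₁, sub_eq_add_neg, neg_ite]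

theorem graphCoeff_triple_mul_edge (hab : a ≠ b) (e f g : Vtx n m × Vtx n m)
    (x : GraphAlg K n m) :
    graphCoeff K ![e, f, g] (x * edge K a b) =
      (if e = (a, b) then graphCoeff K ![f, g] x else 0) -
        (if f = (a, b) then graphCoeff K ![e, g] x else 0) +
          if g = (a, b) then graphCoeff K ![e, f] x else 0 := by
  have hdel₀ : ![e, f, g] ∘ Fin.succ = ![f, g] := rfl
  have hdel₁ : ![e, f, g] ∘ Fin.succAbove 1 = ![e, g] := by
    funext j
    fin_cases j <;> rfl
  have hdel₂ : ![e, f, g] ∘ Fin.succAbove 2 = ![e, f] := by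
    funext j
    fin_cases j <;> rfl
  rw [graphCoeff_mul_edge, Fin.sum_univ_three]
  simp [hab, hdel₀, hdel₁, hdel₂, sub_eq_add_neg, neg_ite, pow_succ]

theorem comp_vecCons {α β : Type*} {k : ℕ} (f : α → β) (a : α) (v : Fin k → α) :
    f ∘ Matrix.vecCons a v = Matrix.vecCons (f a) (f ∘ v) :=
  Fin.comp_cons f a v

theorem comp_vecEmpty {α β : Type*} (f : α → β) : f ∘ ![] = ![] :=
  Subsingleton.elim _ _

end SmallGraphs

section Obstruction

variable {K : Type*} [Field K] {n : ℕ}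

/-- The edge from the `j`-th external vertex to the only internal vertex. -/
abbrev inEdge (j : Fin n) : Vtx n 1 × Vtx n 1 := (Sum.inl j, Sum.inr 0)

/-- The edge from the only internal vertex to the `j`-th external vertex. -/
abbrev outEdge (j : Fin n) : Vtx n 1 × Vtx n 1 := (Sum.inr 0, Sum.inl j)

/-- The edge from the `p`-th to the `q`-th vertex, in the absence of internal vertices. -/
abbrev extEdge (p q : Fin n) : Vtx n 0 × Vtx n 0 := (Sum.inl p, Sum.inl q)

variable (K) in
/-- The coefficient of the tree that represents the bracket. -/
noncomputable def treeCoeff : GraphQuot K 2 1 →ₗ[K] K :=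
  coeff K ![outEdge 0, outEdge 1] (by constructor <;> simp [Fin.forall_fin_succ])

/-- The graph with one internal vertex, which has an incoming edge from `p` and outgoing edges to
`q` and `r`. -/
abbrev corolla (p q r : Fin n) : Fin 3 → Vtx n 1 × Vtx n 1 :=
  ![inEdge p, outEdge q, outEdge r]

theorem internallyTrivalent_corolla (p q r : Fin n) : InternallyTrivalent (corolla p q r) := by
  constructor <;> simp [Fin.forall_fin_succ]

variable (K) in
/-- The alternating sum of the coefficients of the corollas. -/
noncomputable def corollaCoeff : GraphQuot K 3 1 →ₗ[K] K where
  toFun z := alternate fun p q r => coeff K _ (internallyTrivalent_corolla p q r) z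
  map_add' x y := by
    simp only [alternate, map_add]
    ring
  map_smul' c x := by
    simp only [alternate, map_smul, smul_eq_mul, RingHom.id_apply]
    ring

theorem treeCoeff_comp_mk {n₁ n₂ m₁ m₂ : ℕ} (hN : n₁ + n₂ = 1) (hM : m₁ + m₂ = 1)
    (i : Fin (n₁ + 1)) (x : GraphAlg K (n₁ + 1) m₁) (y : GraphAlg K (n₂ + 1) m₂) :
    treeCoeff K (comp K hN hM i (Submodule.Quotient.mk x) (Submodule.Quotient.mk y)) =
      graphCoeff K ![outEdge 0, outEdge 1] (reconnect K (outerVtx (m₂ := m₂) hN hM i) x *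
        reconnect K (fun a => {innerVtx hN hM i a}) y) := rfl

theorem corollaCoeff_comp_mk {n₁ n₂ m₁ m₂ : ℕ} (hN : n₁ + n₂ = 2) (hM : m₁ + m₂ = 1)
    (i : Fin (n₁ + 1)) (x : GraphAlg K (n₁ + 1) m₁) (y : GraphAlg K (n₂ + 1) m₂) :
    corollaCoeff K (comp K hN hM i (Submodule.Quotient.mk x) (Submodule.Quotient.mk y)) =
      alternate fun p q r => graphCoeff K (corolla p q r)
        (reconnect K (outerVtx (m₂ := m₂) hN hM i) x *
          reconnect K (fun a => {innerVtx hN hM i a}) y) := rfl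

theorem treeCoeff_tree : treeCoeff K (Submodule.Quotient.mk (tree K)) = 1 := by
  rw [treeCoeff, coeff_mk, tree, graphCoeff_pair_mul_edge (by simp),
    graphCoeff_single_edge (by simp), graphCoeff_single_edge (by simp)]
  simp

theorem treeCoeff_comp_unit_right (x : GraphQuot K 1 1) :
    treeCoeff K (comp K (zero_add 1) (add_zero 1) 0 x
      (Submodule.Quotient.mk (1 : GraphAlg K 2 0))) = 0 := by
  obtain ⟨x, rfl⟩ := Submodule.Quotient.mk_surjective _ x
  rw [treeCoeff_comp_mk, map_one, mul_one, graphCoeff_outer]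
  exact graphCoeff_eq_zero_of_eq zero_ne_one rfl x

theorem treeCoeff_comp_unit_left (i : Fin 2) (x : GraphQuot K 1 1) :
    treeCoeff K (comp K (add_zero 1) (zero_add 1) i
      (Submodule.Quotient.mk (1 : GraphAlg K 2 0)) x) = 0 := by
  obtain ⟨x, rfl⟩ := Submodule.Quotient.mk_surjective _ x
  rw [treeCoeff_comp_mk, map_one, one_mul]
  refine graphCoeff_inner_eq_zero _ _ _ (j := i.rev) (fun a b h => ?_) x
  fin_cases i <;> rcases b with b | b <;> fin_cases b <;> simp [innerVtx, Fin.rev] at h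

theorem treeCoeff_bracketComponent_unit (x : GraphQuot K 1 1) :
    treeCoeff K (bracketComponent K (zero_add 1) (add_zero 1) x
      (Submodule.Quotient.mk (1 : GraphAlg K 2 0))) = 0 := by
  rw [bracketComponent_binary]
  simp [treeCoeff_comp_unit_left, treeCoeff_comp_unit_right]

theorem corollaCoeff_comp_unit_right (i : Fin 2) (x : GraphQuot K 2 1) :
    corollaCoeff K (comp K (N := 2) rfl (add_zero 1) i x
      (Submodule.Quotient.mk (1 : GraphAlg K 2 0))) = 0 := by
  obtain ⟨x, rfl⟩ := Submodule.Quotient.mk_surjective _ x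
  have hmap (p q r : Fin 3) : Prod.map (Sum.map i.predAbove id) (Sum.map i.predAbove id) ∘
      corolla p q r = corolla (i.predAbove p) (i.predAbove q) (i.predAbove r) := by
    funext j
    fin_cases j <;> rfl
  simp only [corollaCoeff_comp_mk, map_one, mul_one, graphCoeff_outer, collapseVtx_binary, hmap]
  refine alternate_comp_eq_zero (fun p q r => graphCoeff K (corolla p q r) x) fun h => ?_
  simpa using Fintype.card_le_of_injective _ h

theorem corollaCoeff_comp_unit_left (i : Fin 2) (x : GraphQuot K 2 1) :
    corollaCoeff K (comp K (N := 2) rfl (zero_add 1) i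
      (Submodule.Quotient.mk (1 : GraphAlg K 2 0)) x) = 0 := by
  obtain ⟨x, rfl⟩ := Submodule.Quotient.mk_surjective _ x
  obtain ⟨s, hs⟩ : ∃ s : Fin 3, ∀ a : Vtx 2 1,
      innerVtx (N := 2) rfl (zero_add 1) i a ≠ Sum.inl s := by
    refine ⟨if i = 0 then 2 else 0, fun a h => ?_⟩
    rcases a with a | a <;> fin_cases i <;> fin_cases a <;> simp [innerVtx] at h
  simp only [corollaCoeff_comp_mk, map_one, one_mul]
  refine alternate_eq_zero fun p q r hpq hpr hqr => ?_
  obtain rfl | rfl | rfl : s = p ∨ s = q ∨ s = r := by omega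
  · exact graphCoeff_inner_eq_zero _ _ _ (j := 0) (fun a b h => hs a (congr_arg Prod.fst h).symm) x
  · exact graphCoeff_inner_eq_zero _ _ _ (j := 1) (fun a b h => hs b (congr_arg Prod.snd h).symm) x
  · exact graphCoeff_inner_eq_zero _ _ _ (j := 2) (fun a b h => hs b (congr_arg Prod.snd h).symm) x

theorem corollaCoeff_bracketComponent_unit (x : GraphQuot K 2 1) :
    corollaCoeff K (bracketComponent K (N := 2) rfl (add_zero 1) x
      (Submodule.Quotient.mk (1 : GraphAlg K 2 0))) = 0 := by
  rw [bracketComponent_binary]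
  simp [corollaCoeff_comp_unit_left, corollaCoeff_comp_unit_right]

end Obstruction

section Differential

variable {K : Type*} [Field K] {n M : ℕ}

theorem collapseVtx_unary_internal (i : Fin (n + 1)) :
    (collapseVtx (add_zero n) i : Vtx (n + 1) M → Vtx (n + 1) 0) =
      Sum.elim Sum.inl fun _ => Sum.inl i := by
  funext c
  rcases c with l | w <;> grind [collapseVtx]

theorem collapseVtx_binary_internal (i : Fin (n + 1)) :
    (collapseVtx rfl i : Vtx (n + 1 + 1) M → Vtx (n + 1) 0) =
      Sum.elim (Sum.inl ∘ i.predAbove) fun _ => Sum.inl i := by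
  funext c
  rcases c with l | w
  · simp only [collapseVtx, Sum.elim_inl, Function.comp_apply, Fin.predAbove, Fin.lt_def,
      Fin.val_castSucc]
    split_ifs <;> simp [Fin.ext_iff] <;> omega
  · simp [collapseVtx]

/-- The sum of the two graphs with one external vertex, one internal vertex and one edge, which
represents the Chevalley-Eilenberg differential. -/
noncomputable def differentialGraph (K : Type*) [Field K] : GraphAlg K 1 1 :=
  edge K (Sum.inr 0) (Sum.inl 0) + edge K (Sum.inl 0) (Sum.inr 0)

theorem reconnect_inner_differentialGraph (i : Fin (n + 1)) :
    reconnect K (fun a => {innerVtx (add_zero n) (zero_add 1) i a}) (differentialGraph K) =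
      edge K (Sum.inr 0) (Sum.inl i) + edge K (Sum.inl i) (Sum.inr 0) := by
  simp [differentialGraph, reconnect_edge_single, innerVtx]

theorem treeCoeff_comp_differentialGraph (i : Fin 2) (x : GraphAlg K 2 0) :
    treeCoeff K (comp K (add_zero 1) (zero_add 1) i (Submodule.Quotient.mk x)
      (Submodule.Quotient.mk (differentialGraph K))) =
      (if 1 = i then graphCoeff K ![extEdge i 0] x else 0) -
        if 0 = i then graphCoeff K ![extEdge i 1] x else 0 := by
  rw [treeCoeff_comp_mk, reconnect_inner_differentialGraph, mul_add, map_add,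
    graphCoeff_pair_mul_edge (by simp), graphCoeff_pair_mul_edge (by simp)]
  simp [graphCoeff_outer, collapseVtx_unary_internal, comp_vecCons, comp_vecEmpty]

theorem corollaCoeff_comp_differentialGraph (i : Fin 3) (x : GraphAlg K 3 0) :
    corollaCoeff K (comp K (add_zero 2) (zero_add 1) i (Submodule.Quotient.mk x)
      (Submodule.Quotient.mk (differentialGraph K))) = alternate fun p q r =>
      (if p = i then graphCoeff K ![extEdge i q, extEdge i r] x else 0) -
        (if q = i then graphCoeff K ![extEdge p i, extEdge i r] x else 0) +
          if r = i then graphCoeff K ![extEdge p i, extEdge i q] x else 0 := by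
  rw [corollaCoeff_comp_mk]
  refine congr_arg alternate (funext₃ fun p q r => ?_)
  rw [reconnect_inner_differentialGraph, mul_add, map_add, graphCoeff_triple_mul_edge (by simp),
    graphCoeff_triple_mul_edge (by simp)]
  simp only [Nat.reduceAdd, Fin.isValue, Prod.mk.injEq, reduceCtorEq, and_self, ↓reduceIte,
    Sum.inl.injEq, true_and, and_true, Nat.succ_eq_add_one, graphCoeff_outer,
    collapseVtx_unary_internal, comp_vecCons, comp_vecEmpty, Prod.map_apply, Sum.elim_inl,
    Sum.elim_inr, zero_sub, sub_zero, add_zero]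
  ring

theorem graphCoeff_external_inner_eq_zero {k n₁ n₂ m₁ N M : ℕ} (hN : n₁ + n₂ = N)
    (hM : m₁ + 0 = M) (i : Fin (n₁ + 1)) {E : Fin k → Vtx (N + 1) M × Vtx (N + 1) M} {j : Fin k}
    (hj : (E j).1.isRight ∨ (E j).2.isRight) (x : GraphAlg K (n₂ + 1) 0) :
    graphCoeff K E (reconnect K (fun a => {innerVtx hN hM i a}) x) = 0 := by
  refine graphCoeff_inner_eq_zero hN hM i (j := j) (fun a b h => ?_) x
  rcases a with a | a
  · rcases b with b | b
    · simp [h, innerVtx] at hj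
    · exact b.elim0
  · exact a.elim0

theorem treeCoeff_differentialGraph_comp (x : GraphQuot K 2 0) :
    treeCoeff K (comp K (zero_add 1) (add_zero 1) 0
      (Submodule.Quotient.mk (differentialGraph K)) x) = 0 := by
  obtain ⟨x, rfl⟩ := Submodule.Quotient.mk_surjective _ x
  rw [treeCoeff_comp_mk, differentialGraph, edge, edge, ← map_add, reconnect,
    ExteriorAlgebra.map_apply_ι]
  refine graphCoeff_ι_mul_eq_zero (fun j => ?_) _
  exact graphCoeff_external_inner_eq_zero _ _ _ (j := 0) (by fin_cases j <;> simp) x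

theorem isRight_corolla (p q r : Fin n) (j : Fin 3) :
    (corolla p q r j).1.isRight ∨ (corolla p q r j).2.isRight := by
  fin_cases j <;> simp

theorem corollaCoeff_differentialGraph_comp (x : GraphQuot K 3 0) :
    corollaCoeff K (comp K (zero_add 2) (add_zero 1) 0
      (Submodule.Quotient.mk (differentialGraph K)) x) = 0 := by
  obtain ⟨x, rfl⟩ := Submodule.Quotient.mk_surjective _ x
  rw [corollaCoeff_comp_mk]
  refine alternate_eq_zero fun p q r _ _ _ => ?_
  have hE := isRight_corolla p q r
  generalize corolla p q r = E at hE
  rw [differentialGraph, edge, edge, ← map_add, reconnect, ExteriorAlgebra.map_apply_ι]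
  refine graphCoeff_ι_mul_eq_zero (fun j => ?_) _
  exact graphCoeff_external_inner_eq_zero _ _ _ (j := 0) (by exact hE _) x

theorem treeCoeff_bracketComponent_differentialGraph (x : GraphAlg K 2 0) :
    treeCoeff K (bracketComponent K (add_zero 1) (zero_add 1) (Submodule.Quotient.mk x)
      (Submodule.Quotient.mk (differentialGraph K))) =
      graphCoeff K ![extEdge 0 1] x - graphCoeff K ![extEdge 1 0] x := by
  rw [bracketComponent_unary, map_sub, treeCoeff_differentialGraph_comp, map_smul, map_sum]
  simp only [treeCoeff_comp_differentialGraph, Finset.sum_sub_distrib, Finset.sum_ite_eq,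
    Finset.mem_univ, if_true, pow_one, neg_smul, one_smul, neg_sub, sub_zero]

theorem graphCoeff_unit_comp_eq_zero (i : Fin 2) {a b c d : Fin 4} (h : [a, b, c, d].Nodup)
    (x : GraphAlg K 3 0) :
    graphCoeff K ![extEdge a b, extEdge c d]
      (reconnect K (fun a => {innerVtx (N := 3) rfl (zero_add 0) i a}) x) = 0 := by
  obtain ⟨s, hs⟩ : ∃ s : Fin 4, ∀ a : Vtx 3 0,
      innerVtx (N := 3) rfl (zero_add 0) i a ≠ Sum.inl s := by
    refine ⟨if i = 0 then 3 else 0, fun a h => ?_⟩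
    rcases a with a | a <;> fin_cases i <;> fin_cases a <;> simp [innerVtx] at h
  obtain rfl | rfl | rfl | rfl : s = a ∨ s = b ∨ s = c ∨ s = d := by
    clear hs
    revert a b c d s
    decide
  · exact graphCoeff_inner_eq_zero _ _ _ (j := 0) (fun a b h => hs a (congr_arg Prod.fst h).symm) x
  · exact graphCoeff_inner_eq_zero _ _ _ (j := 0) (fun a b h => hs b (congr_arg Prod.snd h).symm) x
  · exact graphCoeff_inner_eq_zero _ _ _ (j := 1) (fun a b h => hs a (congr_arg Prod.fst h).symm) x
  · exact graphCoeff_inner_eq_zero _ _ _ (j := 1) (fun a b h => hs b (congr_arg Prod.snd h).symm) x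

theorem sum_graphCoeff_predAbove_eq_zero {x : GraphAlg K 3 0}
    (hx : bracketComponent K (N := 3) rfl (add_zero 0) (Submodule.Quotient.mk x)
      (Submodule.Quotient.mk (1 : GraphAlg K 2 0)) = 0)
    {a b c d : Fin 4} (h : [a, b, c, d].Nodup) :
    ∑ i : Fin 3, (-1) ^ (i : ℕ) * graphCoeff K ![extEdge (i.predAbove a) (i.predAbove b),
      extEdge (i.predAbove c) (i.predAbove d)] x = 0 := by
  have hcoeff := congr_arg (coeff K ![extEdge a b, extEdge c d]
    ⟨fun v => v.elim0, fun v => v.elim0⟩) hx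
  rw [bracketComponent_binary] at hcoeff
  simpa [comp_mk, coeff_mk, graphCoeff_outer, collapseVtx_binary, comp_vecCons, comp_vecEmpty,
    graphCoeff_unit_comp_eq_zero _ h] using hcoeff

theorem corollaCoeff_bracketComponent_differentialGraph {x : GraphQuot K 3 0}
    (hx : bracketComponent K (N := 3) rfl (add_zero 0) x
      (Submodule.Quotient.mk (1 : GraphAlg K 2 0)) = 0) :
    corollaCoeff K (bracketComponent K (add_zero 2) (zero_add 1) x
      (Submodule.Quotient.mk (differentialGraph K))) = 0 := by
  obtain ⟨x, rfl⟩ := Submodule.Quotient.mk_surjective _ x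
  have hforks : alternate (fun p q r => graphCoeff K ![extEdge p q, extEdge p r] x) = 0 :=
    alternate_eq_zero_of_cocycle (γ := fun u v s t => graphCoeff K ![extEdge u s, extEdge v t] x)
      fun a b c d h => sum_graphCoeff_predAbove_eq_zero hx (by grind)
  have hpaths : alternate (fun p q r => graphCoeff K ![extEdge q p, extEdge p r] x) = 0 :=
    alternate_eq_zero_of_cocycle (γ := fun u v s t => graphCoeff K ![extEdge s u, extEdge v t] x)
      fun a b c d h => sum_graphCoeff_predAbove_eq_zero hx (by grind)
  rw [bracketComponent_unary, map_sub, corollaCoeff_differentialGraph_comp, map_smul, map_sum]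
  have hsum : ∑ i : Fin 3, corollaCoeff K (comp K (add_zero 2) (zero_add 1) i
      (Submodule.Quotient.mk x) (Submodule.Quotient.mk (differentialGraph K))) =
      alternate fun p q r => graphCoeff K ![extEdge p q, extEdge p r] x -
        graphCoeff K ![extEdge p q, extEdge q r] x +
          graphCoeff K ![extEdge p r, extEdge r q] x := by
    simp only [corollaCoeff_comp_differentialGraph, alternate, Finset.sum_add_distrib,
      Finset.sum_sub_distrib, Finset.sum_ite_eq, Finset.mem_univ, if_true]
  rw [hsum, sub_zero, smul_eq_zero]
  right
  unfold alternate at *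
  linear_combination hforks + 2 * hpaths

theorem reconnect_inner_tree (i : Fin 2) :
    reconnect K (fun a => {innerVtx (N := 2) rfl (zero_add 1) i a}) (tree K) =
      edge K (Sum.inr 0) (Sum.inl i.castSucc) * edge K (Sum.inr 0) (Sum.inl i.succ) := by
  simp [tree, reconnect_edge_single, innerVtx, Fin.castSucc, Fin.castAdd, Fin.castLE, Fin.succ]

theorem corollaCoeff_comp_tree (i : Fin 2) (x : GraphAlg K 2 0) :
    corollaCoeff K (comp K (N := 2) rfl (zero_add 1) i (Submodule.Quotient.mk x)
      (Submodule.Quotient.mk (tree K))) = 2 * graphCoeff K ![extEdge i.rev i] x := by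
  have hcoeff (p q r : Fin 3) : graphCoeff K (corolla p q r)
      (reconnect K (outerVtx (n₂ := 1) (m₂ := 1) rfl (zero_add 1) i) x *
        reconnect K (fun a => {innerVtx (N := 2) rfl (zero_add 1) i a}) (tree K)) =
      ((if q = i.castSucc ∧ r = i.succ then 1 else 0) -
        if r = i.castSucc ∧ q = i.succ then 1 else 0) *
          graphCoeff K ![extEdge (i.predAbove p) i] x := by
    rw [reconnect_inner_tree, ← mul_assoc, graphCoeff_triple_mul_edge (by simp),
      graphCoeff_pair_mul_edge (by simp), graphCoeff_pair_mul_edge (by simp),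
      graphCoeff_pair_mul_edge (by simp)]
    simp only [Nat.reduceAdd, Fin.isValue, Prod.mk.injEq, reduceCtorEq, and_self, ↓reduceIte,
      Sum.inl.injEq, true_and, Nat.succ_eq_add_one, graphCoeff_outer, collapseVtx_binary_internal,
      comp_vecCons, comp_vecEmpty, Prod.map_apply, Sum.elim_inl, Sum.elim_inr,
      Function.comp_apply, sub_zero, zero_sub]
    split_ifs <;> simp_all
  rw [corollaCoeff_comp_mk]
  simp only [hcoeff]
  fin_cases i
  all_goals simp [alternate]
  all_goals ring

theorem corollaCoeff_tree_comp (i : Fin 2) (x : GraphQuot K 2 0) :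
    corollaCoeff K (comp K (N := 2) rfl (add_zero 1) i
      (Submodule.Quotient.mk (tree K)) x) = 0 := by
  obtain ⟨x, rfl⟩ := Submodule.Quotient.mk_surjective _ x
  rw [corollaCoeff_comp_mk]
  refine alternate_eq_zero fun p q r _ _ _ => ?_
  have hE := isRight_corolla p q r
  generalize corolla p q r = E at hE
  rw [tree, edge, edge, reconnect, map_mul (ExteriorAlgebra.map _), ExteriorAlgebra.map_apply_ι,
    ExteriorAlgebra.map_apply_ι, mul_assoc]
  refine graphCoeff_ι_mul_eq_zero (fun j => graphCoeff_ι_mul_eq_zero (fun l => ?_) _) _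
  exact graphCoeff_external_inner_eq_zero _ _ _ (j := 0) (by exact hE _) x

theorem corollaCoeff_bracketComponent_tree (x : GraphQuot K 2 0) :
    corollaCoeff K (bracketComponent K (N := 2) rfl (zero_add 1) x
      (Submodule.Quotient.mk (tree K))) =
      -2 * treeCoeff K (bracketComponent K (add_zero 1) (zero_add 1) x
        (Submodule.Quotient.mk (differentialGraph K))) := by
  obtain ⟨x, rfl⟩ := Submodule.Quotient.mk_surjective _ x
  rw [bracketComponent_binary, treeCoeff_bracketComponent_differentialGraph]
  simp only [map_sub, map_smul, map_sum, corollaCoeff_comp_tree, corollaCoeff_tree_comp]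
  rw [Fin.sum_univ_two]
  simp only [Fin.val_zero, Fin.val_one, pow_zero, pow_one, Fin.rev_zero, Fin.reduceLast,
    Fin.reduceRev, smul_eq_mul]
  ring

end Differential

section Gauge

variable {K : Type*} [Field K]

theorem mk_one_ne_zero (n : ℕ) : (Submodule.Quotient.mk 1 : GraphQuot K n 0) ≠ 0 := by
  intro h
  have hcoeff := congr_arg (coeff K (k := 0) ![] ⟨fun v => v.elim0, fun v => v.elim0⟩) h
  rw [coeff_mk, graphCoeff_one, map_zero] at hcoeff
  exact one_ne_zero hcoeff

theorem bracketComponent_unit_unit :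
    bracketComponent K (N := 1) rfl (add_zero 0) (Submodule.Quotient.mk (1 : GraphAlg K 1 0))
      (Submodule.Quotient.mk (1 : GraphAlg K 2 0)) = -Submodule.Quotient.mk 1 := by
  rw [bracketComponent_binary, Fin.sum_univ_one, comp_unit_left]
  simp [comp_unit_right]

theorem exists_eq_smul_one {x : GraphQuot K 1 0} (hx : x ∈ dgraphs K 1 0 0) :
    ∃ c : K, x = c • Submodule.Quotient.mk 1 := by
  have hspan : dgraphs K 1 0 0 ≤ Submodule.span K {Submodule.Quotient.mk 1} := by
    refine Submodule.span_le.2 ?_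
    rintro _ ⟨l, _, hl, rfl⟩
    obtain rfl : l = [] := List.length_eq_zero_iff.1 (by omega)
    exact Submodule.mem_span_singleton_self _
  obtain ⟨c, hc⟩ := Submodule.mem_span_singleton.1 (hspan hx)
  exact ⟨c, hc.symm⟩

theorem iterate_bracket_zero_zero {ξ α : Family K} (hα : α 0 0 = 0) (k : ℕ) :
    (bracket K 0 1 ξ)^[k] α 0 0 = 0 := by
  induction k with
  | zero => exact hα
  | succ k ih => simp [Function.iterate_succ_apply', bracket_apply, ih]

theorem iterate_bracket_one_zero {ξ α : Family K} {c : K}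
    (hξ : ξ 0 0 = c • Submodule.Quotient.mk 1) (hα : α 0 0 = 0)
    (hα' : α 1 0 = Submodule.Quotient.mk 1) (k : ℕ) :
    (bracket K 0 1 ξ)^[k] α 1 0 = (-c) ^ k • Submodule.Quotient.mk 1 := by
  induction k with
  | zero => rw [pow_zero, one_smul, Function.iterate_zero_apply, hα']
  | succ k ih =>
    have hbracket : bracketComponent K (N := 1) rfl (add_zero 0) (ξ 0 0)
        ((bracket K 0 1 ξ)^[k] α 1 0) = (-c) ^ (k + 1) • Submodule.Quotient.mk 1 := by
      rw [ih, hξ, map_smul, map_smul, LinearMap.smul_apply, bracketComponent_unit_unit, smul_neg,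
        smul_neg, smul_smul, ← neg_smul, pow_succ, mul_neg]
    rw [Function.iterate_succ_apply', bracket_apply, ← hbracket]
    simp [Fin.sum_univ_succ, iterate_bracket_zero_zero hα]

theorem zero_zero_eq_zero_of_eventually_sum_eq [CharZero K] {ξ α β : Family K}
    (hξ : ξ ∈ convolution K 0) (hα : α 0 0 = 0) (hα' : α 1 0 = Submodule.Quotient.mk 1)
    (h : ∃ B : ℕ, ∀ b ≥ B, (∑ k ∈ Finset.range b,
      ((k.factorial : K)⁻¹) • (bracket K 0 1 ξ)^[k] α) 1 0 = β 1 0) :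
    ξ 0 0 = 0 := by
  obtain ⟨c, hc⟩ := exists_eq_smul_one (x := ξ 0 0) (by simpa using hξ 0 0)
  obtain ⟨B, hB⟩ := h
  have hterm : ((B.factorial : K)⁻¹) • (-c) ^ B •
      (Submodule.Quotient.mk 1 : GraphQuot K 2 0) = 0 := by
    rw [← iterate_bracket_one_zero hc hα hα', ← Pi.smul_apply, ← Pi.smul_apply]
    have hsucc := hB (B + 1) (by omega)
    rwa [Finset.sum_range_succ, Pi.add_apply, Pi.add_apply, hB B le_rfl, add_eq_left] at hsucc
  rw [smul_smul, smul_eq_zero_iff_left (mk_one_ne_zero 2), mul_eq_zero, inv_eq_zero,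
    Nat.cast_eq_zero] at hterm
  have hzero : c = 0 := neg_eq_zero.1 (eq_zero_of_pow_eq_zero
    (hterm.resolve_left B.factorial_ne_zero))
  rw [hc, hzero, zero_smul]

theorem iterate_bracket_eq_zero {ξ α : Family K} (hξ : ξ 0 0 = 0) (hα : α 0 0 = 0) {k N M : ℕ}
    (h : N + M ≤ k) : (bracket K 0 1 ξ)^[k] α N M = 0 := by
  induction k generalizing N M with
  | zero =>
    obtain ⟨rfl, rfl⟩ : N = 0 ∧ M = 0 := by omega
    exact hα
  | succ k ih =>
    rw [Function.iterate_succ_apply', bracket_apply]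
    refine Finset.sum_eq_zero fun i _ => Finset.sum_eq_zero fun j _ => ?_
    by_cases hij : (i : ℕ) = 0 ∧ (j : ℕ) = 0
    · have hzero : ξ i j = 0 := by rw [hij.1, hij.2, hξ]
      rw [hzero, map_zero, LinearMap.zero_apply]
    · rw [ih (by omega), map_zero]

theorem sum_range_eq_of_eventually {V : Type*} [AddCommMonoid V] {u : ℕ → V} {v : V} {N : ℕ}
    (hu : ∀ k ≥ N, u k = 0) (h : ∃ B : ℕ, ∀ b ≥ B, ∑ k ∈ Finset.range b, u k = v) :
    ∑ k ∈ Finset.range N, u k = v := by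
  obtain ⟨B, hB⟩ := h
  rw [← hB (max B N) (le_max_left _ _)]
  refine Finset.sum_subset (Finset.range_mono (le_max_right _ _)) fun k _ hk => hu k ?_
  simpa using hk

theorem GaugeEquiv.exists_sum_iterate_bracket_eq [CharZero K] {α β : Family K}
    (h : GaugeEquiv K α β) (hα : α 0 0 = 0) (hα' : α 1 0 = Submodule.Quotient.mk 1) :
    ∃ ξ : Family K, ξ 0 0 = 0 ∧ ∀ N M, ∑ k ∈ Finset.range (N + M),
      ((k.factorial : K)⁻¹) • (bracket K 0 1 ξ)^[k] α N M = β N M := by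
  obtain ⟨ξ, hξ, hsum⟩ := h
  have hzero := zero_zero_eq_zero_of_eventually_sum_eq hξ hα hα' (hsum 1 0)
  refine ⟨ξ, hzero, fun N M => sum_range_eq_of_eventually (fun k hk => ?_) ?_⟩
  · rw [iterate_bracket_eq_zero hzero hα hk, smul_zero]
  · simpa only [Finset.sum_apply, Pi.smul_apply] using hsum N M

theorem bracket_three_zero {ξ α : Family K} (hξ : ξ 0 0 = 0) (hα : α 0 0 = 0) :
    bracket K 0 1 ξ α 3 0 = bracketComponent K (N := 3) rfl (add_zero 0) (ξ 1 0) (α 2 0) +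
      bracketComponent K (N := 3) rfl (add_zero 0) (ξ 2 0) (α 1 0) := by
  simp [bracket_apply, Fin.sum_univ_succ, hξ, hα]

theorem bracket_one_one {ξ α : Family K} (hξ : ξ 0 0 = 0) (hα : α 0 0 = 0) :
    bracket K 0 1 ξ α 1 1 = bracketComponent K (zero_add 1) (add_zero 1) (ξ 0 1) (α 1 0) +
      bracketComponent K (add_zero 1) (zero_add 1) (ξ 1 0) (α 0 1) := by
  simp [bracket_apply, Fin.sum_univ_succ, hξ, hα]

theorem bracket_two_one {ξ α : Family K} (hξ : ξ 0 0 = 0) (hα : α 0 0 = 0) :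
    bracket K 0 1 ξ α 2 1 = bracketComponent K (zero_add 2) (add_zero 1) (ξ 0 1) (α 2 0) +
      bracketComponent K (N := 2) rfl (zero_add 1) (ξ 1 0) (α 1 1) +
      bracketComponent K (N := 2) rfl (add_zero 1) (ξ 1 1) (α 1 0) +
      bracketComponent K (add_zero 2) (zero_add 1) (ξ 2 0) (α 0 1) := by
  simp [bracket_apply, Fin.sum_univ_succ, hξ, hα, add_assoc]

theorem GaugeEquiv.exists_low_components [CharZero K] {a : Series K 1} {b b' : Series K 2}
    (h : GaugeEquiv K (strictElement K a b) (strictElement K a b')) (ha : a 0 = 0)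
    (hb : b 0 = Submodule.Quotient.mk 1) :
    ∃ (x : GraphQuot K 1 1) (y : GraphQuot K 2 0) (z : GraphQuot K 3 0) (w : GraphQuot K 2 1),
      bracketComponent K (zero_add 1) (add_zero 1) x (b 0) +
        bracketComponent K (add_zero 1) (zero_add 1) y (a 1) = b' 1 - b 1 ∧
      bracketComponent K (N := 3) rfl (add_zero 0) z (b 0) = 0 ∧
      bracketComponent K (N := 2) rfl (zero_add 1) y (b 1 + b' 1) +
        (2 : K) • (bracketComponent K (N := 2) rfl (add_zero 1) w (b 0) +
          bracketComponent K (add_zero 2) (zero_add 1) z (a 1)) = 0 := by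
  obtain ⟨ξ, hξ, hsum⟩ := h.exists_sum_iterate_bracket_eq ha hb
  have hα : bracket K 0 1 ξ (strictElement K a b) 0 0 = 0 :=
    iterate_bracket_eq_zero (k := 1) hξ ha (by omega)
  have h10 : bracket K 0 1 ξ (strictElement K a b) 1 0 = 0 :=
    iterate_bracket_eq_zero (k := 1) hξ ha (by omega)
  have h01 : bracket K 0 1 ξ (strictElement K a b) 0 1 = 0 :=
    iterate_bracket_eq_zero (k := 1) hξ ha (by omega)
  have h20 : bracket K 0 1 ξ (strictElement K a b) 2 0 = 0 := by
    simpa [Finset.sum_range_succ, strictElement] using hsum 2 0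
  have h11 : bracket K 0 1 ξ (strictElement K a b) 1 1 = b' 1 - b 1 := by
    rw [eq_sub_iff_add_eq']
    simpa [Finset.sum_range_succ, strictElement] using hsum 1 1
  have h30 : bracketComponent K (N := 3) rfl (add_zero 0) (ξ 2 0) (b 0) = 0 := by
    simpa [Finset.sum_range_succ, strictElement, bracket_three_zero hξ, ha, hα, h10, h20]
      using hsum 3 0
  have h21 : bracketComponent K (N := 2) rfl (zero_add 1) (ξ 1 0) (b 1) +
      bracketComponent K (N := 2) rfl (add_zero 1) (ξ 1 1) (b 0) +
      bracketComponent K (add_zero 2) (zero_add 1) (ξ 2 0) (a 1) +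
      (2 : K)⁻¹ • bracketComponent K (N := 2) rfl (zero_add 1) (ξ 1 0) (b' 1 - b 1) = 0 := by
    simpa [Finset.sum_range_succ, strictElement, bracket_two_one hξ, ha, hα, h10, h01, h20, h11]
      using hsum 2 1
  refine ⟨ξ 0 1, ξ 1 0, ξ 2 0, ξ 1 1, ?_, h30, ?_⟩
  · rw [← h11, bracket_one_one hξ ha]
    rfl
  · rw [map_sub] at h21
    rw [map_add]
    linear_combination (norm := module) (2 : K) • h21

end Gauge

end DufloGraph

open DufloGraph in
theorem mainTheorem2_general {K : Type*} [Field K] [CharZero K] {b b' : Series K 2}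
    (h : GaugeEquiv K (strictElement K (differential K) b) (strictElement K (differential K) b'))
    {c c' : K} (h₀ : b 0 = Submodule.Quotient.mk 1) (h₁ : b 1 = c • Submodule.Quotient.mk (tree K))
    (h₁' : b' 1 = c' • Submodule.Quotient.mk (tree K)) : c ^ 2 = c' ^ 2 := by
  obtain ⟨x, y, z, w, h11, h30, h21⟩ := h.exists_low_components rfl h₀
  rw [h₀] at h11 h30 h21
  rw [show differential K 1 = Submodule.Quotient.mk (differentialGraph K) from rfl] at h11 h21
  have htree : treeCoeff K (bracketComponent K (add_zero 1) (zero_add 1) y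
      (Submodule.Quotient.mk (differentialGraph K))) = c' - c := by
    have h := congr_arg (treeCoeff K) h11
    rwa [map_add, treeCoeff_bracketComponent_unit, zero_add, h₁, h₁', ← sub_smul, map_smul,
      treeCoeff_tree, smul_eq_mul, mul_one] at h
  have hcorolla := congr_arg (corollaCoeff K) h21
  rw [h₁, h₁', ← add_smul, map_smul, map_add, map_smul, map_smul, map_add,
    corollaCoeff_bracketComponent_tree, htree, corollaCoeff_bracketComponent_unit,
    corollaCoeff_bracketComponent_differentialGraph h30, map_zero] at hcorolla
  simp only [smul_eq_mul, add_zero, mul_zero] at hcorolla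
  have htwo : (2 : K) * (c ^ 2 - c' ^ 2) = 0 := by linear_combination hcorolla
  exact sub_eq_zero.1 ((mul_eq_zero.1 htwo).resolve_left two_ne_zero)

theorem mainTheorem2 (K : Type*) [Field K] [CharZero K] :
    ¬ DufloGraph.GaugeEquiv K (DufloGraph.alphaDuf K) (DufloGraph.alphaZero K) := by
  intro h
  have hsq := mainTheorem2_general h DufloGraph.dufloProduct_zero DufloGraph.dufloProduct_one
    (zero_smul K _).symm
  norm_num at hsq
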